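/- **Definitions.** A *planar map* is a finite connected planar graph, with loops and multiple edges allowed, embedded in the oriented sphere up to continuous deformation. The *degree* of a face is its number of corners, and the *girth* of a map is the minimal length of its simple cycles ($\infty$ if it has no cycle; a loop is a cycle of length $1$, and two parallel edges form a cycle of length $2$). Let $3\le d\le p$ be integers. A *$p$-annular $d$-angulation* is a planar map with two distinct marked faces, the *boundary face* and the *root-face*, such that the boundary face has degree $p$ and simple contour (its $p$ corners are at distinct vertices), and every other face has degree $d$. *Boundary vertices* are the vertices incident to the boundary face. An *$\mathbb N$-biorientation* of a map declares each half-edge *ingoing* (oriented toward its incident vertex) or *outgoing* (oriented toward the middle of its edge), and gives it a weight in $\mathbb N=\{0,1,2,\dots\}$ which is positive for ingoing half-edges and $0$ for outgoing ones. The weight of an edge is the sum of the weights of its two half-edges; the weight of a vertex is the sum of the weights of the ingoing half-edges incident to it. An edge is *1-way* if exactly one of its half-edges is ingoing. A *directed path* may follow an edge toward an end $v$ whenever the half-edge at $v$ is ingoing. A *circuit* is a simple closed directed path (no vertex or edge used twice); it is *clockwise* if the root-face lies on its left, and *counterclockwise* otherwise. An $\mathbb N$-biorientation is *minimal* if it has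 no counterclockwise circuit, and *accessible from a vertex $v$* if every vertex can be reached from $v$ by a directed path. A *pseudo $d/(d-2)$-orientation* of a $p$-annular $d$-angulation is an $\mathbb N$-biorientation in which every edge has weight $d-2$, every non-boundary vertex has weight $d$, and the contour of the boundary face is a clockwise circuit of 1-way edges. **Proposition.** Let $3\le d\le p$, and let $A$ be a $p$-annular $d$-angulation. Then $A$ admits a pseudo $d/(d-2)$-orientation if and only if $A$ has girth $d$. In this case, $A$ admits a unique minimal pseudo $d/(d-2)$-orientation, and this orientation is accessible from every boundary vertex. -/

import Mathlib

/-- A planar map (a finite connected graph, loops and multiple edges allowed, embedded in the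
oriented sphere, up to deformation), encoded by its set `H` of half-edges.
`rot` sends a half-edge to the next one in counterclockwise order around its vertex, and `opp` sends
a half-edge to the other half of its edge. Vertices, edges and faces are the cycles of `rot`, `opp`
and `rot * opp`; connectedness is transitivity of the generated group, and the underlying surface is
the sphere exactly when Euler's relation holds.
(The map with one vertex and no edge has no half-edge and is not covered: it has no cycle.) -/
structure PlanarMap (H : Type*) [Fintype H] where
  rot : Equiv.Perm H
  opp : Equiv.Perm H
  opp_opp : ∀ h, opp (opp h) = h
  opp_ne : ∀ h, opp h ≠ h
  connected : MulAction.IsPretransitive (Subgroup.closure {rot, opp}) H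
  euler : Nat.card (Quotient (Equiv.Perm.SameCycle.setoid rot))
      + Nat.card (Quotient (Equiv.Perm.SameCycle.setoid (rot * opp)))
      = Nat.card (Quotient (Equiv.Perm.SameCycle.setoid opp)) + 2

namespace PlanarMap

variable {H : Type*} [Fintype H] (M : PlanarMap H)

/-- Vertices: cycles of `rot`. -/
abbrev Vertex : Type _ := Quotient (Equiv.Perm.SameCycle.setoid M.rot)

/-- Edges: pairs of opposite half-edges. -/
abbrev Edge : Type _ := Quotient (Equiv.Perm.SameCycle.setoid M.opp)

/-- Faces: cycles of `rot * opp`. If `h` is followed from its vertex to the other end of its edge,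
then `rot (opp h)` is the next half-edge met when walking with the same face on the right. -/
abbrev Face : Type _ := Quotient (Equiv.Perm.SameCycle.setoid (M.rot * M.opp))

/-- The edge containing the half-edge `h`. -/
def edge (h : H) : M.Edge := Quotient.mk _ h

/-- The vertex incident to `h`, i.e. the origin of the edge when it is traversed starting with
`h`. -/
def source (h : H) : M.Vertex := Quotient.mk _ h

/-- The other end of the edge of `h`. -/
def target (h : H) : M.Vertex := M.source (M.opp h)

/-- The face on the right of `h`, when the edge is traversed starting with `h`. -/
def rightFace (h : H) : M.Face := Quotient.mk _ h

/-- The face on the left of `h`, when the edge is traversed starting with `h`. -/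
def leftFace (h : H) : M.Face := M.rightFace (M.opp h)

/-- The degree of a face: the number of its corners, i.e. of half-edges having it on their right. -/
noncomputable def faceDegree (f : M.Face) : ℕ := Nat.card {h : H // M.rightFace h = f}

/-- The contour of the face `f` is simple: the vertices met around `f` are all distinct. -/
def SimpleContour (f : M.Face) : Prop :=
  ∀ h k : H, M.rightFace h = f → M.rightFace k = f → M.source h = M.source k → h = k

/-- The vertex `v` is incident to the face `f`. -/
def VertexOnFace (v : M.Vertex) (f : M.Face) : Prop := ∃ h, M.rightFace h = f ∧ M.source h = v

/-- The edge `e` is incident to the face `f`. -/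
def EdgeOnFace (e : M.Edge) (f : M.Face) : Prop := ∃ h, M.rightFace h = f ∧ M.edge h = e

/-- A simple cycle with a direction and a starting point: a cyclic sequence of `len ≥ 1` traversed
half-edges, each ending where the next one starts, no vertex and no edge being used twice.
Loops are cycles of length `1` and pairs of parallel edges give cycles of length `2`. -/
structure SimpleCycle where
  len : ℕ
  [len_ne_zero : NeZero len]
  dart : Fin len → H
  closed : ∀ i, M.target (dart i) = M.source (dart (i + 1))
  vertex_injective : Function.Injective fun i => M.source (dart i)
  edge_injective : Function.Injective fun i => M.edge (dart i)

attribute [instance] SimpleCycle.len_ne_zero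

/-- The girth: the minimal length of a cycle (`⊤` if there is no cycle). -/
noncomputable def girth : ℕ∞ := ⨅ c : M.SimpleCycle, (c.len : ℕ∞)

variable {M}

/-- The edge `e` is used by the cycle `c`. -/
def SimpleCycle.HasEdge (c : M.SimpleCycle) (e : M.Edge) : Prop := ∃ i, M.edge (c.dart i) = e

/-- The faces `f` and `g` share an edge that is not on the cycle `c`. -/
def SimpleCycle.AdjOff (c : M.SimpleCycle) (f g : M.Face) : Prop :=
  ∃ h, ¬ c.HasEdge (M.edge h) ∧ M.rightFace h = f ∧ M.leftFace h = g

/-- The face `f` is on the left of the directed cycle `c`: some face on the left of a directed edge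
of `c` can be joined to `f` without crossing `c`. -/
def SimpleCycle.FaceOnLeft (c : M.SimpleCycle) (f : M.Face) : Prop :=
  ∃ i, Relation.ReflTransGen c.AdjOff (M.leftFace (c.dart i)) f

/-- With respect to the root-face `r`, a directed cycle is clockwise if `r` is on its left. -/
def SimpleCycle.Clockwise (c : M.SimpleCycle) (r : M.Face) : Prop := c.FaceOnLeft r

/-- With respect to the root-face `r`, a directed cycle is counterclockwise if it is not
clockwise. -/
def SimpleCycle.Counterclockwise (c : M.SimpleCycle) (r : M.Face) : Prop := ¬ c.Clockwise r

/-- An `ℕ`-biorientation: every half-edge is either ingoing (oriented toward its vertex) or outgoing,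
and carries a weight in `ℕ` that is positive if it is ingoing and nonpositive if it is outgoing. -/
@[ext]
structure NBiorientation (M : PlanarMap H) where
  ingoing : Set H
  weight : H → ℕ
  weight_pos : ∀ h, h ∈ ingoing → 0 < weight h
  weight_nonpos : ∀ h, h ∉ ingoing → weight h ≤ 0

namespace NBiorientation

variable (O : M.NBiorientation)

/-- The weight of the edge containing `h`: the sum of the weights of its two halves. -/
def edgeWeight (h : H) : ℕ := O.weight h + O.weight (M.opp h)

open Classical in
/-- The weight of a vertex: the sum of the weights of the incident ingoing half-edges. -/
noncomputable def vertexWeight (v : M.Vertex) : ℕ :=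
  ∑ h : H with M.source h = v ∧ h ∈ O.ingoing, O.weight h

/-- The edge of `h` may be followed from the vertex of `h` to its other end: the half-edge at the
other end is ingoing, i.e. the edge is 2-way, or 1-way oriented toward that end. -/
def Traversable (h : H) : Prop := M.opp h ∈ O.ingoing

/-- The edge of `h` is 1-way: exactly one of its halves is ingoing. -/
def OneWay (h : H) : Prop := Xor (h ∈ O.ingoing) (M.opp h ∈ O.ingoing)

/-- A circuit: a simple cycle that is a directed path. -/
def IsCircuit (c : M.SimpleCycle) : Prop := ∀ i, O.Traversable (c.dart i)

/-- Every vertex can be reached from `v` by a directed path. -/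
def AccessibleFrom (v : M.Vertex) : Prop :=
  ∀ u, Relation.ReflTransGen
    (fun a b => ∃ h, O.Traversable h ∧ M.source h = a ∧ M.target h = b) v u

/-- No counterclockwise circuit, with respect to the root-face `r`. -/
def Minimal (r : M.Face) : Prop := ∀ c, O.IsCircuit c → ¬ c.Counterclockwise r

end NBiorientation

end PlanarMap

/-- A `p`-gonal `d`-angulation: a planar map with a marked face of degree `p` with simple contour,
the boundary face, all other faces having degree `d`. -/
structure GonalAngulation (H : Type*) [Fintype H] (p d : ℕ) extends PlanarMap H where
  boundary : toPlanarMap.Face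
  degree_boundary : toPlanarMap.faceDegree boundary = p
  simple_boundary : toPlanarMap.SimpleContour boundary
  degree_other : ∀ f, f ≠ boundary → toPlanarMap.faceDegree f = d

/-- A `p`-annular `d`-angulation: a `p`-gonal `d`-angulation with a root-face that is not the
boundary face. -/
structure AnnularAngulation (H : Type*) [Fintype H] (p d : ℕ) extends GonalAngulation H p d where
  root : toPlanarMap.Face
  root_ne_boundary : root ≠ boundary

namespace AnnularAngulation

variable {H : Type*} [Fintype H] {p d : ℕ} (A : AnnularAngulation H p d)

/-- Boundary vertices: those incident to the boundary face. -/
def BoundaryVertex (v : A.Vertex) : Prop := A.VertexOnFace v A.boundary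

/-- A pseudo `d/(d-2)`-orientation: the edges have weight `d-2`, the non-boundary vertices have
weight `d`, and the contour of the boundary face is a clockwise circuit of 1-way edges. -/
structure IsPseudoOrientation (O : A.NBiorientation) : Prop where
  edge_weight : ∀ h, O.edgeWeight h = d - 2
  vertex_weight : ∀ v, ¬ A.BoundaryVertex v → O.vertexWeight v = d
  boundary_circuit : ∃ c : A.SimpleCycle, (∀ e, c.HasEdge e ↔ A.EdgeOnFace e A.boundary) ∧
    O.IsCircuit c ∧ c.Clockwise A.root ∧ ∀ i, O.OneWay (c.dart i)

end AnnularAngulation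

/-! The engine is discrete homology on the sphere. Gradients of vertex functions and curls of face
functions are orthogonal subspaces of `ℝ^E`. By connectedness both kernels are the constants, so
Euler's relation makes the two spaces orthogonal complements. Restricted to a set of edges
(`finrank_vanishingOn_add`), this duality gives Euler's inequalities for submaps, face potentials of
flows, and Jordan's theorem in the form of a potential that jumps across a cycle.

The root-face yields a cycle of length at most `d`. Given a pseudo-orientation and a cycle `c`,
consider the side of `c` away from the boundary face: its inner vertices have weight `d`, supplied
by inner edges of weight `d - 2`, and its faces have degree `d`. Euler's inequality then forces `c`
to have length at least `d` (`le_len_of_isPseudoOrientation`).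

Conversely, girth at least `d` makes edge sets sparse: `(d - 2)|F| < d|X|` when `F` lives on the
vertex set `X`, with a sharper bound when `F` contains the contour of the boundary face
(`sparse_of_girth`, `sparse_of_girth_of_face`). Sparsity is Hall's condition for distributing the
units of edge weight among the vertices (`exists_distribution`), whence existence. Applied to the
set of unreachable vertices it gives accessibility.

Two pseudo-orientations differ by the curl of a potential on the non-boundary faces
(`exists_potential_sub`). Reversing a unit of weight along a counterclockwise circuit raises this
potential on the side away from the root-face. There are finitely many pseudo-orientations, so the
process stops at a minimal one (`exists_minimal`). If the potential between two of them is not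
constant, then a counterclockwise circuit of one of them borders the set where it is extremal
(`not_minimal_of_potential`), so the minimal one is unique. -/

namespace PlanarMap

/-! ### Half-edges, connectedness, and simple cycles inside cuts. -/

section Basics

variable {H : Type*} [Fintype H] (M : PlanarMap H)

noncomputable instance : Fintype M.Vertex := Fintype.ofFinite _
noncomputable instance : Fintype M.Edge := Fintype.ofFinite _
noncomputable instance : Fintype M.Face := Fintype.ofFinite _

@[simp] lemma opp_opp_apply (h : H) : M.opp (M.opp h) = h := M.opp_opp h

lemma opp_injective : Function.Injective M.opp := M.opp.injective

lemma source_eq_iff {h k : H} : M.source h = M.source k ↔ M.rot.SameCycle h k := Quotient.eq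

lemma rightFace_eq_iff {h k : H} :
    M.rightFace h = M.rightFace k ↔ (M.rot * M.opp).SameCycle h k := Quotient.eq

@[simp] lemma source_rot (h : H) : M.source (M.rot h) = M.source h :=
  M.source_eq_iff.2 ((Equiv.Perm.sameCycle_apply_left).2 (Equiv.Perm.SameCycle.refl _ _))

@[simp] lemma rightFace_rot_opp (h : H) : M.rightFace (M.rot (M.opp h)) = M.rightFace h :=
  M.rightFace_eq_iff.2 ((Equiv.Perm.sameCycle_apply_left).2 (Equiv.Perm.SameCycle.refl _ _))

@[simp] lemma rightFace_rot (h : H) : M.rightFace (M.rot h) = M.leftFace h := by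
  have := M.rightFace_rot_opp (M.opp h)
  rwa [M.opp_opp] at this

@[simp] lemma edge_opp (h : H) : M.edge (M.opp h) = M.edge h :=
  Quotient.sound ((Equiv.Perm.sameCycle_apply_left).2 (Equiv.Perm.SameCycle.refl _ _))

@[simp] lemma source_opp (h : H) : M.source (M.opp h) = M.target h := rfl

@[simp] lemma target_opp (h : H) : M.target (M.opp h) = M.source h := by simp [target]

@[simp] lemma rightFace_opp (h : H) : M.rightFace (M.opp h) = M.leftFace h := rfl

@[simp] lemma leftFace_opp (h : H) : M.leftFace (M.opp h) = M.rightFace h := by simp [leftFace]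

lemma perm_induction {π : Equiv.Perm H} {h k : H} (hk : π.SameCycle h k) {P : H → Prop}
    (h0 : P h) (step : ∀ x, P x → P (π x)) : P k := by
  obtain ⟨n, -, rfl⟩ := hk.exists_pow_eq'
  clear hk
  induction n with
  | zero => simpa
  | succ n ih => rw [pow_succ']; exact step _ ih

lemma edge_eq_iff {h k : H} : M.edge h = M.edge k ↔ k = h ∨ k = M.opp h := by
  constructor
  · intro e
    refine perm_induction (π := M.opp) (Quotient.eq.1 e) (P := fun k => k = h ∨ k = M.opp h)
      (Or.inl rfl) ?_
    rintro x (rfl | rfl) <;> simp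
  · rintro (rfl | rfl) <;> simp

lemma edge_out (h : H) : (M.edge h).out = h ∨ (M.edge h).out = M.opp h :=
  M.edge_eq_iff.1 (Quotient.out_eq (M.edge h)).symm

@[simp] lemma edge_out_eq (e : M.Edge) : M.edge e.out = e := Quotient.out_eq e

@[simp] lemma source_out_eq (v : M.Vertex) : M.source v.out = v := Quotient.out_eq v

@[simp] lemma rightFace_out_eq (f : M.Face) : M.rightFace f.out = f := Quotient.out_eq f

lemma apply_eq_apply_of_connected {α : Type*} (f : H → α) (hr : ∀ h, f (M.rot h) = f h)
    (ho : ∀ h, f (M.opp h) = f h) (h k : H) : f h = f k := by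
  obtain ⟨⟨g, hg⟩, rfl⟩ := M.connected.exists_smul_eq h k
  have : ∀ x, f (g x) = f x := by
    induction hg using Subgroup.closure_induction with
    | mem x hx =>
      rcases hx with rfl | rfl
      · exact hr
      · exact ho
    | one => simp
    | mul a b _ _ ha hb => intro x; rw [Equiv.Perm.mul_apply, ha, hb]
    | inv a _ ha => intro x; rw [← ha, Equiv.Perm.inv_def, Equiv.apply_symm_apply]
  exact (this h).symm

lemma vertex_apply_eq {α : Type*} (p : M.Vertex → α)
    (hp : ∀ h, p (M.target h) = p (M.source h)) (u v : M.Vertex) : p u = p v := by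
  induction u using Quotient.inductionOn with | h h =>
  induction v using Quotient.inductionOn with | h k =>
  exact M.apply_eq_apply_of_connected (fun h => p (M.source h)) (by simp) hp h k

lemma face_apply_eq {α : Type*} (q : M.Face → α)
    (hq : ∀ h, q (M.leftFace h) = q (M.rightFace h)) (f g : M.Face) : q f = q g := by
  induction f using Quotient.inductionOn with | h h =>
  induction g using Quotient.inductionOn with | h k =>
  exact M.apply_eq_apply_of_connected (fun h => q (M.rightFace h)) (by simpa using hq) hq h k

open Classical in
/-- The curl of a face potential has no divergence. -/
lemma sum_curl_eq_zero {R : Type*} [AddCommGroup R] (q : M.Face → R) (v : M.Vertex) :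
    ∑ h with M.source h = v, (q (M.leftFace h) - q (M.rightFace h)) = 0 := by
  rw [Finset.sum_sub_distrib, sub_eq_zero]
  -- The face on the left of `h` is the face on the right of `rot h`, so `rot` matches the two sums.
  refine Finset.sum_bij (fun h _ => M.rot h) (by simp) (by simp) ?_ (by simp)
  intro k hk
  refine ⟨M.rot.symm k, ?_, by simp⟩
  have := M.source_rot (M.rot.symm k)
  rw [Equiv.apply_symm_apply] at this
  simpa [← this] using hk

variable {M}

/-- A nonempty set of darts that contains no dart together with its reverse, and in which every
dart has a successor, contains a simple cycle. -/
lemma exists_simpleCycle {D : Set H} (hD : D.Nonempty) (hanti : ∀ h ∈ D, M.opp h ∉ D)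
    (hnext : ∀ h ∈ D, ∃ k ∈ D, M.source k = M.target h) :
    ∃ c : M.SimpleCycle, ∀ i, c.dart i ∈ D := by
  classical
  obtain ⟨h0, hh0⟩ := hD
  choose! nx nxD nxs using hnext
  let s : ℕ → H := fun n => nx^[n] h0
  have sD : ∀ n, s n ∈ D := by
    intro n
    induction n with
    | zero => exact hh0
    | succ n ih => simp only [s, Function.iterate_succ_apply']; exact nxD _ ih
  have ss : ∀ n, M.source (s (n + 1)) = M.target (s n) := by
    intro n
    simp only [s, Function.iterate_succ_apply']; exact nxs _ (sD n)
  -- Cutting the infinite walk at the least gap `l` between two visits to the same vertex leaves a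
  -- closed walk with distinct vertices.
  have hex : ∃ l, 0 < l ∧ ∃ m, M.source (s m) = M.source (s (m + l)) := by
    obtain ⟨a, b, hab, e⟩ := Finite.exists_ne_map_eq_of_infinite fun n => M.source (s n)
    rcases lt_or_gt_of_ne hab with hlt | hlt
    · exact ⟨b - a, by omega, a, by rw [Nat.add_sub_cancel' hlt.le]; exact e⟩
    · exact ⟨a - b, by omega, b, by rw [Nat.add_sub_cancel' hlt.le]; exact e.symm⟩
  obtain ⟨hl, m, hm⟩ := Nat.find_spec hex
  have hmin : ∀ l' < Nat.find hex, 0 < l' → ∀ m, M.source (s m) ≠ M.source (s (m + l')) :=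
    fun l' hl' h1 m h2 => Nat.find_min hex hl' ⟨h1, m, h2⟩
  generalize Nat.find hex = l at hl hm hmin
  have hinj : ∀ i j : Fin l, M.source (s (m + i)) = M.source (s (m + j)) → i = j := by
    have key : ∀ i j : Fin l, i < j → M.source (s (m + i)) ≠ M.source (s (m + j)) := by
      intro i j hij
      have := hmin (j - i) (by omega) (by omega) (m + i)
      rwa [show m + (i : ℕ) + (j - i) = m + j by omega] at this
    intro i j e
    rcases lt_trichotomy i j with h | h | h
    · exact absurd e (key i j h)
    · exact h
    · exact absurd e.symm (key j i h)
  have : NeZero l := ⟨hl.ne'⟩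
  refine ⟨⟨l, fun i => s (m + i), ?_, fun i j e => hinj i j e, ?_⟩, fun i => sD _⟩
  · intro i
    rw [← ss]
    rcases Nat.lt_or_ge (i + 1) l with h | h
    · congr 2
      rw [Fin.val_add_one_of_lt' h]; rfl
    · have hi : (i : ℕ) + 1 = l := by omega
      have h0 : ((i + 1 : Fin l) : ℕ) = 0 := by
        rw [Fin.val_add, Fin.val_one', Nat.add_mod_mod, hi, Nat.mod_self]
      rw [h0, add_assoc, hi, add_zero, hm]
  · intro i j e
    rcases M.edge_eq_iff.1 e with h | h
    · exact hinj i j (by rw [h])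
    · exact absurd (h ▸ sD (m + j)) (hanti _ (sD (m + i)))

/-- The edges separating a nonempty proper set of faces from its complement contain a simple
cycle having the set on its left. -/
lemma exists_simpleCycle_of_faces {S : Set M.Face} {f g : M.Face} (hf : f ∈ S) (hg : g ∉ S) :
    ∃ c : M.SimpleCycle, ∀ i, M.leftFace (c.dart i) ∈ S ∧ M.rightFace (c.dart i) ∉ S := by
  classical
  refine exists_simpleCycle (D := {h | M.leftFace h ∈ S ∧ M.rightFace h ∉ S}) ?_ ?_ ?_
  · by_contra hne
    rw [Set.not_nonempty_iff_eq_empty] at hne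
    have hno : ∀ h, M.leftFace h ∈ S → M.rightFace h ∈ S := by
      intro h h1
      by_contra h2
      exact (Set.mem_empty_iff_false h).1 (hne ▸ ⟨h1, h2⟩)
    have := M.face_apply_eq (fun x => x ∈ S) (fun h => propext ⟨hno h, fun h1 => by
      simpa using hno (M.opp h) (by simpa using h1)⟩) f g
    exact hg (this ▸ hf)
  · rintro h ⟨h1, h2⟩ ⟨h3, h4⟩
    exact h4 (by simpa using h1)
  · rintro h ⟨h1, h2⟩
    -- Conservation for the indicator of `S`: at this vertex `opp h` contributes -1, so some dart
    -- contributes +1 and continues the cut.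
    have hs := M.sum_curl_eq_zero (fun x => if x ∈ S then (1 : ℤ) else 0) (M.target h)
    by_contra hcon
    push Not at hcon
    refine absurd hs (ne_of_lt (Finset.sum_neg' ?_ ⟨M.opp h, by simp, by simp [h1, h2]⟩))
    intro k hk
    rw [Finset.mem_filter] at hk
    have hk' : ¬ (M.leftFace k ∈ S ∧ M.rightFace k ∉ S) := fun hk' => hcon k hk' hk.2
    by_cases ha : M.leftFace k ∈ S <;> by_cases hb : M.rightFace k ∈ S <;> simp_all

end Basics

end PlanarMap

/-! ### Rank duality for orthogonal linear maps. -/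

section LinearAlgebra

/-- Two orthogonal ranges in `ℝ^ι`: their ranks add up to at most `|ι|`, and if they add up to
`|ι|` then each vector orthogonal to the first lies in the second. -/
lemma finrank_range_add_finrank_range_le {ι U W : Type*} [Fintype ι] [AddCommGroup U] [Module ℝ U]
    [AddCommGroup W] [Module ℝ W] (f : U →ₗ[ℝ] ι → ℝ) (g : W →ₗ[ℝ] ι → ℝ)
    (orth : ∀ u w, ∑ i, f u i * g w i = 0) :
    Module.finrank ℝ f.range + Module.finrank ℝ g.range ≤ Fintype.card ι ∧
    (Fintype.card ι ≤ Module.finrank ℝ f.range + Module.finrank ℝ g.range →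
      ∀ z : ι → ℝ, (∀ u, ∑ i, f u i * z i = 0) → ∃ w, g w = z) := by
  let e : (ι → ℝ) ≃ₗ[ℝ] EuclideanSpace ℝ ι := (WithLp.linearEquiv 2 ℝ (ι → ℝ)).symm
  have inn : ∀ x y : ι → ℝ, inner ℝ (e x) (e y) = ∑ i, x i * y i := by
    intro x y
    simp only [e, PiLp.inner_apply, WithLp.linearEquiv_symm_apply]
    exact Finset.sum_congr rfl fun i _ => by simp [mul_comm]
  let K : Submodule ℝ (EuclideanSpace ℝ ι) := f.range.map e.toLinearMap
  let L : Submodule ℝ (EuclideanSpace ℝ ι) := g.range.map e.toLinearMap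
  have hK : Module.finrank ℝ K = Module.finrank ℝ f.range := LinearEquiv.finrank_map_eq e _
  have hL : Module.finrank ℝ L = Module.finrank ℝ g.range := LinearEquiv.finrank_map_eq e _
  have hmem : ∀ z : ι → ℝ, e z ∈ Kᗮ ↔ ∀ u, ∑ i, f u i * z i = 0 := by
    intro z
    rw [Submodule.mem_orthogonal]
    constructor
    · intro h u
      rw [← inn]
      exact h _ (Submodule.mem_map_of_mem ⟨u, rfl⟩)
    · rintro h _ ⟨_, ⟨u, rfl⟩, rfl⟩
      exact (inn _ _).trans (h u)
  have hLK : L ≤ Kᗮ := by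
    rintro _ ⟨_, ⟨w, rfl⟩, rfl⟩
    exact (hmem _).2 fun u => orth u w
  have hadd := K.finrank_add_finrank_orthogonal
  rw [finrank_euclideanSpace] at hadd
  have hle := Submodule.finrank_mono hLK
  refine ⟨by omega, fun hge z hz => ?_⟩
  have heq : L = Kᗮ := Submodule.eq_of_le_of_finrank_le hLK (by omega)
  have : e z ∈ L := heq ▸ (hmem z).2 hz
  obtain ⟨_, ⟨w, rfl⟩, h⟩ := this
  exact ⟨w, e.injective h⟩

variable {E P Q : Type*} [AddCommGroup P] [Module ℝ P] [AddCommGroup Q] [Module ℝ Q]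

/-- The vectors whose image under `f` vanishes on `s`. -/
def vanishingOn (f : P →ₗ[ℝ] E → ℝ) (s : Set E) : Submodule ℝ P where
  carrier := {x | ∀ e ∈ s, f x e = 0}
  add_mem' ha hb e he := by simp [ha e he, hb e he]
  zero_mem' e _ := by simp
  smul_mem' c x hx e he := by simp [hx e he]

/-- The restriction of `f` to the coordinates in `s`. -/
def restrictCoord (f : P →ₗ[ℝ] E → ℝ) (s : Set E) : P →ₗ[ℝ] s → ℝ :=
  LinearMap.funLeft ℝ ℝ (Subtype.val : s → E) ∘ₗ f

lemma ker_restrictCoord (f : P →ₗ[ℝ] E → ℝ) (s : Set E) :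
    (restrictCoord f s).ker = vanishingOn f s := by
  ext x
  simp [restrictCoord, vanishingOn, funext_iff, LinearMap.funLeft]

lemma finrank_ker_restrictCoord_vanishingOn (f : P →ₗ[ℝ] E → ℝ) (s : Set E) :
    Module.finrank ℝ ((restrictCoord f s).domRestrict (vanishingOn f sᶜ)).ker
      = Module.finrank ℝ f.ker := by
  have h : f.ker ≤ vanishingOn f sᶜ := by
    intro x hx e _
    rw [LinearMap.mem_ker] at hx
    simp [hx]
  have key : (vanishingOn f s).comap (vanishingOn f sᶜ).subtype
      = f.ker.comap (vanishingOn f sᶜ).subtype := by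
    ext ⟨x, hx⟩
    simp only [Submodule.mem_comap, Submodule.subtype_apply, LinearMap.mem_ker]
    constructor
    · intro h1
      ext e
      by_cases he : e ∈ s
      · exact h1 e he
      · exact hx e he
    · intro h1 e _
      simp [h1]
  rw [LinearMap.ker_domRestrict, ker_restrictCoord, key]
  exact (Submodule.comapSubtypeEquivOfLe h).finrank_eq

/-- Rank duality for orthogonal maps `f`, `g` of complementary ranks. -/
lemma finrank_vanishingOn_add [Fintype E] [FiniteDimensional ℝ P] [FiniteDimensional ℝ Q]
    (f : P →ₗ[ℝ] E → ℝ) (g : Q →ₗ[ℝ] E → ℝ) (orth : ∀ u w, ∑ i, f u i * g w i = 0)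
    (hf : Module.finrank ℝ f.ker = 1) (hg : Module.finrank ℝ g.ker = 1)
    (hE : Module.finrank ℝ P + Module.finrank ℝ Q = Fintype.card E + 2) (s : Set E) :
    Module.finrank ℝ (vanishingOn f sᶜ) + Module.finrank ℝ Q
      = s.ncard + Module.finrank ℝ (vanishingOn g s) + 1 ∧
    ∀ z : E → ℝ, (∀ p ∈ vanishingOn f sᶜ, ∑ e, f p e * z e = 0) → ∃ q, ∀ e ∈ s, g q e = z e := by
  classical
  have sums : ∀ (t : Set E) [Fintype t] (a b : E → ℝ), (∀ e ∈ tᶜ, a e * b e = 0) →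
      ∑ e : t, a e * b e = ∑ e, a e * b e := by
    intro t _ a b h
    rw [← Finset.sum_subset (Finset.subset_univ t.toFinset)
      (fun e _ he => h e (by simpa using he))]
    exact (Finset.sum_subtype t.toFinset (by simp) (fun e => a e * b e)).symm
  -- The rank bounds on `s` and on `sᶜ` add up to `dim P + dim Q - 2 ≤ |E|`. By `hE` this is an
  -- equality, so both bounds are sharp; sharpness on `s` also gives the second claim.
  obtain ⟨h1, h1'⟩ := finrank_range_add_finrank_range_le
    ((restrictCoord f s).domRestrict (vanishingOn f sᶜ)) (restrictCoord g s) (by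
      rintro ⟨u, hu⟩ w
      rw [← orth u w, ← sums s]
      · rfl
      · intro e he
        rw [hu e he, zero_mul])
  obtain ⟨h2, -⟩ := finrank_range_add_finrank_range_le
    (restrictCoord f sᶜ) ((restrictCoord g sᶜ).domRestrict (vanishingOn g sᶜᶜ)) (by
      rintro u ⟨w, hw⟩
      rw [← orth u w, ← sums sᶜ]
      · rfl
      · intro e he
        rw [hw e he, mul_zero])
  have r1 := ((restrictCoord f s).domRestrict (vanishingOn f sᶜ)).finrank_range_add_finrank_ker
  have r2 := (restrictCoord g s).finrank_range_add_finrank_ker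
  have r3 := (restrictCoord f sᶜ).finrank_range_add_finrank_ker
  have r4 := ((restrictCoord g sᶜ).domRestrict (vanishingOn g sᶜᶜ)).finrank_range_add_finrank_ker
  rw [finrank_ker_restrictCoord_vanishingOn] at r1 r4
  rw [ker_restrictCoord] at r2 r3
  rw [← Nat.card_eq_fintype_card, Nat.card_coe_set_eq] at h1 h2 h1'
  have hc := Set.ncard_add_ncard_compl s
  rw [Nat.card_eq_fintype_card] at hc
  rw [compl_compl] at r4 h2
  refine ⟨by omega, fun z hz => ?_⟩
  obtain ⟨q, hq⟩ := h1' (by omega) (fun e => z e) (by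
    rintro ⟨u, hu⟩
    rw [← hz u hu, ← sums s]
    · rfl
    · intro e he
      rw [hu e he, zero_mul])
  exact ⟨q, fun e he => congr_fun hq ⟨e, he⟩⟩

end LinearAlgebra

/-! ### Gradient, curl, and Jordan's theorem. -/

namespace PlanarMap

section Homology

variable {H : Type*} [Fintype H] (M : PlanarMap H)

/-- The gradient of a function on the vertices, read along a chosen direction of each edge. -/
noncomputable def grad : (M.Vertex → ℝ) →ₗ[ℝ] M.Edge → ℝ where
  toFun p e := p (M.target e.out) - p (M.source e.out)
  map_add' p q := by ext e; simp; ring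
  map_smul' c p := by ext e; simp; ring

/-- The curl of a function on the faces, read along a chosen direction of each edge. -/
noncomputable def curl : (M.Face → ℝ) →ₗ[ℝ] M.Edge → ℝ where
  toFun p e := p (M.leftFace e.out) - p (M.rightFace e.out)
  map_add' p q := by ext e; simp; ring
  map_smul' c p := by ext e; simp; ring

lemma grad_edge_eq_zero_iff (p : M.Vertex → ℝ) (h : H) :
    M.grad p (M.edge h) = 0 ↔ p (M.target h) = p (M.source h) := by
  change p _ - p _ = 0 ↔ _
  rcases M.edge_out h with e | e <;> rw [e, sub_eq_zero]
  simp [eq_comm]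

lemma curl_edge_eq_zero_iff (q : M.Face → ℝ) (h : H) :
    M.curl q (M.edge h) = 0 ↔ q (M.leftFace h) = q (M.rightFace h) := by
  change q _ - q _ = 0 ↔ _
  rcases M.edge_out h with e | e <;> rw [e, sub_eq_zero]
  simp [eq_comm]

lemma mem_vanishingOn_grad {p : M.Vertex → ℝ} {F : Set M.Edge} :
    p ∈ vanishingOn M.grad F ↔ ∀ h, M.edge h ∈ F → p (M.target h) = p (M.source h) := by
  constructor
  · intro hp h hh
    exact (M.grad_edge_eq_zero_iff p h).1 (hp _ hh)
  · intro hp e he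
    have := (M.grad_edge_eq_zero_iff p e.out).2 (hp _ (by simpa using he))
    simpa using this

lemma mem_vanishingOn_curl {q : M.Face → ℝ} {F : Set M.Edge} :
    q ∈ vanishingOn M.curl F ↔ ∀ h, M.edge h ∈ F → q (M.leftFace h) = q (M.rightFace h) := by
  constructor
  · intro hp h hh
    exact (M.curl_edge_eq_zero_iff q h).1 (hp _ hh)
  · intro hp e he
    have := (M.curl_edge_eq_zero_iff q e.out).2 (hp _ (by simpa using he))
    simpa using this

lemma sum_eq_sum_edge {R : Type*} [AddCommMonoid R] (g : H → R) :
    ∑ h, g h = ∑ e : M.Edge, (g e.out + g (M.opp e.out)) := by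
  classical
  rw [← Finset.sum_fiberwise (s := Finset.univ) (g := M.edge) (f := g)]
  refine Finset.sum_congr rfl fun e _ => ?_
  rw [← Finset.sum_pair (M.opp_ne e.out).symm]
  refine Finset.sum_congr ?_ fun _ _ => rfl
  ext h
  have := M.edge_eq_iff (h := e.out) (k := h)
  rw [edge_out_eq] at this
  simp [← this, eq_comm]

/-- Summation by parts: an antisymmetric `z` is a flow on the edges, and each half-edge is charged
to its own vertex. -/
lemma sum_grad_mul (p : M.Vertex → ℝ) (z : H → ℝ) (hz : ∀ h, z (M.opp h) = - z h) :
    ∑ e, M.grad p e * z e.out = - ∑ h, p (M.source h) * z h := by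
  rw [M.sum_eq_sum_edge, ← Finset.sum_neg_distrib]
  refine Finset.sum_congr rfl fun e _ => ?_
  change (p _ - p _) * _ = _
  rw [hz, source_opp]
  ring

lemma sum_source_mul (p : M.Vertex → ℝ) (z : H → ℝ)
    (hz : ∀ v, p v ≠ 0 → (open Classical in ∑ h with M.source h = v, z h) = 0) :
    ∑ h, p (M.source h) * z h = 0 := by
  classical
  rw [← Finset.sum_fiberwise (s := Finset.univ) (g := M.source)]
  refine Finset.sum_eq_zero fun v _ => ?_
  rw [Finset.sum_congr rfl (g := fun h => p v * z h)
    (fun h hh => by rw [(Finset.mem_filter.1 hh).2]), ← Finset.mul_sum]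
  by_cases hp : p v = 0
  · rw [hp, zero_mul]
  · convert mul_zero _
    convert hz v hp

lemma sum_grad_mul_curl (p : M.Vertex → ℝ) (q : M.Face → ℝ) :
    ∑ e, M.grad p e * M.curl q e = 0 := by
  refine (M.sum_grad_mul p (fun h => q (M.leftFace h) - q (M.rightFace h)) (by simp)).trans ?_
  rw [neg_eq_zero]
  exact M.sum_source_mul p _ fun v _ => M.sum_curl_eq_zero q v

lemma nonempty {H : Type*} [Fintype H] (M : PlanarMap H) : Nonempty H := by
  by_contra h
  rw [not_nonempty_iff] at h
  have := M.euler
  simp only [Nat.card_of_isEmpty] at this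
  omega

instance : Nonempty M.Vertex := M.nonempty.map M.source
instance : Nonempty M.Face := M.nonempty.map M.rightFace

lemma finrank_eq_one_of_constants {ι : Type*} [Nonempty ι] [Finite ι] (K : Submodule ℝ (ι → ℝ))
    (h1 : (fun _ => 1) ∈ K) (hK : ∀ x ∈ K, ∀ i j, x i = x j) : Module.finrank ℝ K = 1 := by
  refine finrank_eq_one (⟨_, h1⟩ : K) ?_ ?_
  · intro h
    have := congr_fun (congrArg Subtype.val h) (Classical.arbitrary ι)
    simp at this
  · rintro ⟨w, hw⟩
    refine ⟨w (Classical.arbitrary ι), ?_⟩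
    ext i
    simp [hK w hw i (Classical.arbitrary ι)]

lemma finrank_ker_grad : Module.finrank ℝ M.grad.ker = 1 := by
  refine finrank_eq_one_of_constants _ ?_ fun p hp => M.vertex_apply_eq p fun h => ?_
  · rw [LinearMap.mem_ker]
    ext e
    simp [grad]
  · rw [← M.grad_edge_eq_zero_iff, LinearMap.mem_ker.1 hp]; rfl

lemma finrank_ker_curl : Module.finrank ℝ M.curl.ker = 1 := by
  refine finrank_eq_one_of_constants _ ?_ fun p hp => M.face_apply_eq p fun h => ?_
  · rw [LinearMap.mem_ker]
    ext e
    simp [curl]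
  · rw [← M.curl_edge_eq_zero_iff, LinearMap.mem_ker.1 hp]; rfl

lemma euler_card : Nat.card M.Vertex + Nat.card M.Face = Nat.card M.Edge + 2 := M.euler

/-- Euler's relation for a spanning submap: the first rank is the number of its components, the
second one is the number of its faces. -/
lemma finrank_vanishingOn_grad_add (F : Set M.Edge) :
    Module.finrank ℝ (vanishingOn M.grad F) + F.ncard + 1
      = Nat.card M.Vertex + Module.finrank ℝ (vanishingOn M.curl Fᶜ) := by
  have he := M.euler_card
  have := (finrank_vanishingOn_add M.grad M.curl M.sum_grad_mul_curl M.finrank_ker_grad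
    M.finrank_ker_curl (by simpa [Nat.card_eq_fintype_card] using he) Fᶜ).1
  rw [compl_compl, Module.finrank_fintype_fun_eq_card, ← Nat.card_eq_fintype_card] at this
  have hc := Set.ncard_add_ncard_compl F
  omega

/-- A flow that is orthogonal to the gradients vanishing off `s` is the curl of a face potential
on `s`. -/
lemma exists_face_potential (s : Set M.Edge) (z : H → ℝ) (hz : ∀ h, z (M.opp h) = - z h)
    (h0 : ∀ p : M.Vertex → ℝ, (∀ h, M.edge h ∉ s → p (M.target h) = p (M.source h)) →
      ∑ h, p (M.source h) * z h = 0) :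
    ∃ q : M.Face → ℝ, ∀ h, M.edge h ∈ s → q (M.leftFace h) - q (M.rightFace h) = z h := by
  have he := M.euler_card
  obtain ⟨q, hq⟩ := (finrank_vanishingOn_add M.grad M.curl M.sum_grad_mul_curl M.finrank_ker_grad
    M.finrank_ker_curl (by simpa [Nat.card_eq_fintype_card] using he) s).2 (fun e => z e.out) (by
      intro p hp
      rw [M.sum_grad_mul p z hz, h0 p (fun h hh => M.mem_vanishingOn_grad.1 hp h hh), neg_zero])
  refine ⟨q, fun h hh => ?_⟩
  have : q (M.leftFace (M.edge h).out) - q (M.rightFace (M.edge h).out) = z (M.edge h).out :=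
    hq _ hh
  rcases M.edge_out h with e | e <;> rw [e] at this
  · exact this
  · rw [hz, leftFace_opp, rightFace_opp] at this
    linarith

/-- Jordan's theorem: the left and the right of a simple cycle are separated by a potential. -/
lemma SimpleCycle.exists_separating_potential {M : PlanarMap H} (c : M.SimpleCycle) :
    ∃ q : M.Face → ℝ, (∀ i, q (M.leftFace (c.dart i)) = q (M.rightFace (c.dart i)) + 1) ∧
      ∀ h, ¬ c.HasEdge (M.edge h) → q (M.leftFace h) = q (M.rightFace h) := by
  classical
  -- The unit flow along the cycle. It is conserved because the cycle is closed, so it is the curl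
  -- of a potential, which jumps by 1 across the cycle and nowhere else.
  let z : H → ℝ := fun h =>
    ∑ i, ((if c.dart i = h then 1 else 0) - (if M.opp (c.dart i) = h then 1 else 0))
  have hz : ∀ h, z (M.opp h) = - z h := by
    intro h
    simp only [z, ← Finset.sum_neg_distrib]
    refine Finset.sum_congr rfl fun i _ => ?_
    simp only [M.opp_injective.eq_iff, neg_sub]
    congr 2
    rw [← M.opp_injective.eq_iff, M.opp_opp]
  obtain ⟨q, hq⟩ := M.exists_face_potential Set.univ z hz (by
    intro p _
    simp only [z, Finset.mul_sum]
    rw [Finset.sum_comm]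
    simp only [mul_sub, mul_ite, mul_one, mul_zero, Finset.sum_sub_distrib, Finset.sum_ite_eq,
      Finset.mem_univ, if_true, source_opp, c.closed]
    rw [sub_eq_zero]
    exact (Equiv.sum_comp (Equiv.addRight (1 : Fin c.len)) fun i => p (M.source (c.dart i))).symm)
  refine ⟨q, fun i => ?_, fun h hh => ?_⟩
  · have h1 := hq (c.dart i) trivial
    have h2 : z (c.dart i) = 1 := by
      simp only [z]
      rw [Finset.sum_eq_single i]
      · simp [M.opp_ne]
      · intro j _ hj
        have n1 : c.dart j ≠ c.dart i := fun e => hj (c.edge_injective (congrArg M.edge e))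
        have n2 : M.opp (c.dart j) ≠ c.dart i := fun e =>
          hj (c.edge_injective (by simp [← e]))
        simp [n1, n2]
      · simp
    linarith
  · have h1 := hq h trivial
    have h2 : z h = 0 := by
      refine Finset.sum_eq_zero fun i _ => ?_
      have n1 : c.dart i ≠ h := fun e => hh ⟨i, congrArg M.edge e⟩
      have n2 : M.opp (c.dart i) ≠ h := fun e => hh ⟨i, by simp [← e]⟩
      simp [n1, n2]
    linarith

end Homology

end PlanarMap

/-! ### Euler's inequalities, and sparsity from girth. -/

namespace PlanarMap

section Counting

variable {H : Type*} [Fintype H] (M : PlanarMap H)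

/-- The faces `f` and `g` share an edge that is not in `F`. -/
def AdjAvoiding (F : Set M.Edge) (f g : M.Face) : Prop :=
  ∃ h, M.edge h ∉ F ∧ M.rightFace h = f ∧ M.leftFace h = g

/-- The faces of the submap with edge set `F`. -/
abbrev Region (F : Set M.Edge) : Type _ := Quot (M.AdjAvoiding F)

/-- The region containing the face `f`. -/
def region (F : Set M.Edge) (f : M.Face) : M.Region F := Quot.mk _ f

variable {M}

lemma region_left_eq {F : Set M.Edge} {h : H} (hh : M.edge h ∉ F) :
    M.region F (M.leftFace h) = M.region F (M.rightFace h) :=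
  (Quot.sound ⟨h, hh, rfl, rfl⟩).symm

lemma finrank_le_of_determined {ι κ : Type*} [Finite ι] [Finite κ] (K : Submodule ℝ (ι → ℝ))
    (r : κ → ι) (hK : ∀ x ∈ K, (∀ k, x (r k) = 0) → x = 0) :
    Module.finrank ℝ K ≤ Nat.card κ := by
  have := Fintype.ofFinite κ
  have h := LinearMap.finrank_le_finrank_of_injective
    (f := (LinearMap.funLeft ℝ ℝ r).domRestrict K) (by
      rw [← LinearMap.ker_eq_bot, LinearMap.ker_eq_bot']
      rintro ⟨x, hx⟩ h0
      exact Subtype.ext (hK x hx fun k => congr_fun h0 k))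
  rwa [Module.finrank_fintype_fun_eq_card, ← Nat.card_eq_fintype_card] at h

lemma le_finrank_of_factors {ι κ : Type*} [Finite ι] [Finite κ] (K : Submodule ℝ (ι → ℝ))
    (a : ι → κ) (ha : Function.Surjective a) (hK : ∀ y : κ → ℝ, y ∘ a ∈ K) :
    Nat.card κ ≤ Module.finrank ℝ K := by
  have := Fintype.ofFinite κ
  have h := LinearMap.finrank_le_finrank_of_injective
    (f := (LinearMap.funLeft ℝ ℝ a).codRestrict K hK) (by
      intro x y h
      exact ha.injective_comp_right (congrArg Subtype.val h))
  rwa [Module.finrank_fintype_fun_eq_card, ← Nat.card_eq_fintype_card] at h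

/-- Collapsing `X` to one point (`none`) leaves `|ι| - |X| + 1` points, and every function on the
quotient pulls back into `K`. -/
lemma le_finrank_of_constant_on {ι : Type*} [Finite ι] (K : Submodule ℝ (ι → ℝ)) (X : Set ι)
    (hX : X.Nonempty) (hK : ∀ y : ι → ℝ, (∀ i ∈ X, ∀ j ∈ X, y i = y j) → y ∈ K) :
    Nat.card ι + 1 ≤ Module.finrank ℝ K + X.ncard := by
  classical
  have h := le_finrank_of_factors K
    (fun i => if h : i ∈ X then none else some (⟨i, h⟩ : (Xᶜ : Set ι))) (by
      rintro (_ | ⟨i, hi⟩)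
      · obtain ⟨i, hi⟩ := hX
        exact ⟨i, by simp [hi]⟩
      · exact ⟨i, dif_neg hi⟩)
    (fun y => hK _ fun i hi j hj => by simp [hi, hj])
  rw [Finite.card_option, Nat.card_coe_set_eq] at h
  have := Set.ncard_add_ncard_compl X
  omega

/-- Euler's inequality for a submap with edge set `F` and vertex set `X`. -/
lemma ncard_add_two_le (F : Set M.Edge) (X : Set M.Vertex) (hX : X.Nonempty)
    (hF : ∀ h, M.edge h ∈ F → M.source h ∈ X) :
    F.ncard + 2 ≤ X.ncard + Nat.card (M.Region F) := by
  have h1 := M.finrank_vanishingOn_grad_add F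
  have h2 := le_finrank_of_constant_on (vanishingOn M.grad F) X hX fun y hy =>
    M.mem_vanishingOn_grad.2 fun h hh =>
      hy _ (hF (M.opp h) (by simpa using hh)) _ (hF h hh)
  have h3 : Module.finrank ℝ (vanishingOn M.curl Fᶜ) ≤ Nat.card (M.Region F) := by
    refine finrank_le_of_determined _ (fun C : M.Region F => C.out) ?_
    intro q hq h0
    rw [mem_vanishingOn_curl] at hq
    ext f
    let q' : M.Region F → ℝ := Quot.lift q (by
      rintro _ _ ⟨h, hh, rfl, rfl⟩
      exact (hq h hh).symm)
    calc q f = q' (M.region F f) := rfl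
      _ = q' (M.region F (M.region F f).out) := congrArg q' (Quot.out_eq (M.region F f)).symm
      _ = 0 := h0 _
  omega

/-- Euler's inequality for the complement of a connected set of faces. -/
lemma ncard_inner_edges_lt (T : Set M.Face) (t f₀ : M.Face) (ht : t ∈ T) (hf₀ : f₀ ∉ T)
    (hT : ∀ f ∈ T, Relation.ReflTransGen
      (fun f g => f ∈ T ∧ g ∈ T ∧ ∃ h, M.rightFace h = f ∧ M.leftFace h = g) t f) :
    {e | ∀ h, M.edge h = e → M.rightFace h ∉ T}.ncard + 1 ≤
      Tᶜ.ncard + {v | ∀ h, M.source h = v → M.rightFace h ∉ T}.ncard := by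
  set In : Set M.Edge := {e | ∀ h, M.edge h = e → M.rightFace h ∉ T} with hIn
  set Iv : Set M.Vertex := {v | ∀ h, M.source h = v → M.rightFace h ∉ T} with hIv
  -- Euler's relation for the edges bordering `T`. As `T` is connected, a potential with zero
  -- gradient on them takes a single value on all vertices touching `T`; and face functions constant
  -- off `T` have no curl on `In`.
  have h1 := M.finrank_vanishingOn_grad_add Inᶜ
  rw [compl_compl] at h1
  have hc := Set.ncard_add_ncard_compl In
  have he := M.euler_card
  have h2 := le_finrank_of_constant_on (vanishingOn M.curl In) Tᶜ ⟨f₀, hf₀⟩ fun y hy =>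
    M.mem_vanishingOn_curl.2 fun h hh =>
      hy _ (hh (M.opp h) (by simp)) _ (hh h rfl)
  have h3 : Module.finrank ℝ (vanishingOn M.grad Inᶜ) ≤ Iv.ncard + 1 := by
    rw [← Nat.card_coe_set_eq, ← Finite.card_option]
    refine finrank_le_of_determined _
      (fun o : Option Iv => o.elim (M.source t.out) Subtype.val) ?_
    intro p hp h0
    rw [mem_vanishingOn_grad] at hp
    have hstep : ∀ h, M.rightFace h ∈ T → p (M.target h) = p (M.source h) := by
      intro h hh
      exact hp h fun hin => hin h rfl hh
    have hface : ∀ f ∈ T, ∀ h k, M.rightFace h = f → M.rightFace k = f →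
        p (M.source h) = p (M.source k) := by
      intro f hf h k hh hk
      refine (perm_induction (M.rightFace_eq_iff.1 (hh.trans hk.symm))
        (P := fun x => M.rightFace x = f ∧ p (M.source h) = p (M.source x)) ⟨hh, rfl⟩ ?_).2
      rintro x ⟨hx, e⟩
      simp only [Equiv.Perm.mul_apply, rightFace_rot_opp, source_rot, source_opp, hx, true_and]
      rw [e, hstep x (hx ▸ hf)]
    have hall : ∀ f ∈ T, ∀ h, M.rightFace h = f → p (M.source h) = 0 := by
      intro f hf
      induction hT f hf with
      | refl =>
        intro h hh
        rw [hface t ht h t.out hh (by simp)]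
        exact h0 none
      | tail _ hst ih =>
        obtain ⟨hb, hc, k, hkb, hkc⟩ := hst
        intro h hh
        rw [hface _ hc h (M.opp k) hh hkc, source_opp, hstep k (hkb ▸ hb)]
        exact ih hb k hkb
    ext v
    by_cases hv : v ∈ Iv
    · exact h0 (some ⟨v, hv⟩)
    · simp only [hIv, Set.mem_ofPred_eq, not_forall, not_not] at hv
      obtain ⟨h, rfl, hh⟩ := hv
      exact hall _ hh h rfl
  have h4 := Set.ncard_add_ncard_compl T
  omega

/-- Each edge has two halves. -/
lemma ncard_halves (F : Set M.Edge) : {h | M.edge h ∈ F}.ncard = 2 * F.ncard := by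
  classical
  rw [Set.ncard_eq_toFinset_card', Set.ncard_eq_toFinset_card', Set.toFinset_ofPred,
    Finset.card_filter, M.sum_eq_sum_edge]
  simp only [edge_out_eq, edge_opp]
  rw [Finset.sum_add_distrib, ← two_mul, ← Finset.card_filter]
  congr 2
  ext; simp

/-- If each simple cycle has length at least `d` and there are several regions, then each region
has at least `d` sides. -/
lemma le_ncard_sides {d : ℕ} (hg : ∀ c : M.SimpleCycle, d ≤ c.len) (F : Set M.Edge)
    (C C' : M.Region F) (hC : C' ≠ C) :
    d ≤ {h | M.edge h ∈ F ∧ M.region F (M.leftFace h) = C}.ncard := by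
  obtain ⟨f, rfl⟩ := Quot.exists_rep C
  obtain ⟨g, rfl⟩ := Quot.exists_rep C'
  -- The cut around the region contains a simple cycle, each dart of which is a side of the region.
  obtain ⟨c, hc⟩ := exists_simpleCycle_of_faces (S := {x | M.region F x = M.region F f})
    (f := f) (g := g) rfl hC
  refine (hg c).trans ?_
  have hinj : Function.Injective c.dart := fun i j e => c.edge_injective (congrArg M.edge e)
  have := Set.ncard_le_ncard (s := Set.range c.dart)
    (t := {h | M.edge h ∈ F ∧ M.region F (M.leftFace h) = M.region F f}) (by
      rintro _ ⟨i, rfl⟩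
      refine ⟨?_, (hc i).1⟩
      by_contra hF
      exact (hc i).2 ((region_left_eq hF).symm.trans (hc i).1)) (Set.toFinite _)
  rwa [Set.ncard_range_of_injective hinj, Nat.card_fin] at this

lemma sum_ncard_sides (F : Set M.Edge) [Fintype (M.Region F)] :
    ∑ C, {h | M.edge h ∈ F ∧ M.region F (M.leftFace h) = C}.ncard = 2 * F.ncard := by
  classical
  rw [← ncard_halves, Set.ncard_eq_toFinset_card',
    Finset.card_eq_sum_card_fiberwise (f := fun h => M.region F (M.leftFace h))
      (t := Finset.univ) (by simp)]
  refine Finset.sum_congr rfl fun C _ => ?_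
  rw [Set.ncard_eq_toFinset_card']
  congr 1
  ext h
  simp

/-- In a map of girth at least `d`, a set of edges is sparse. -/
lemma sparse_of_girth {d : ℕ} (hd : 3 ≤ d) (hg : ∀ c : M.SimpleCycle, d ≤ c.len)
    (F : Set M.Edge) (X : Set M.Vertex) (hX : X.Nonempty)
    (hF : ∀ h, M.edge h ∈ F → M.source h ∈ X) : (d - 2) * F.ncard < d * X.ncard := by
  have := Fintype.ofFinite (M.Region F)
  have h1 := ncard_add_two_le F X hX hF
  obtain ⟨e, rfl⟩ : ∃ e, d = e + 2 := ⟨d - 2, by omega⟩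
  simp only [Nat.add_sub_cancel]
  by_cases hsub : ∃ C C' : M.Region F, C' ≠ C
  · obtain ⟨C, C', hC⟩ := hsub
    -- Each edge has two sides and each region at least `d` of them; eliminating the number of
    -- regions from Euler's inequality gives the bound.
    have h2 : (e + 2) * Nat.card (M.Region F) ≤ 2 * F.ncard := by
      rw [← sum_ncard_sides, Nat.card_eq_fintype_card, mul_comm, ← smul_eq_mul]
      refine Finset.card_nsmul_le_sum _ _ _ fun D _ => ?_
      by_cases h : C = D
      · exact le_ncard_sides hg F D C' (h ▸ hC)
      · exact le_ncard_sides hg F D C h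
    nlinarith
  · push Not at hsub
    have : Nat.card (M.Region F) ≤ 1 :=
      Finite.card_le_one_iff_subsingleton.2 ⟨fun a b => hsub b a⟩
    nlinarith

/-- In a map of girth at least `d`, a set of edges containing the contour of a face of degree `p`,
each edge of which is incident to another face, is sparse. -/
lemma sparse_of_girth_of_face {d : ℕ} (hd : 3 ≤ d) (hg : ∀ c : M.SimpleCycle, d ≤ c.len)
    (F : Set M.Edge) (X : Set M.Vertex) (b : M.Face)
    (hb : ∀ h, M.rightFace h = b → M.edge h ∈ F ∧ M.leftFace h ≠ b)
    (hF : ∀ h, M.edge h ∈ F → M.source h ∈ X) :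
    (d - 2) * F.ncard + d + M.faceDegree b ≤ d * X.ncard := by
  classical
  have := Fintype.ofFinite (M.Region F)
  have hb1 := hb b.out (by simp)
  have h1 := ncard_add_two_le F X ⟨_, hF _ hb1.1⟩ hF
  obtain ⟨e, rfl⟩ : ∃ e, d = e + 2 := ⟨d - 2, by omega⟩
  simp only [Nat.add_sub_cancel]
  -- All edges around `b` lie in `F`, so `b` is a region by itself and its exact degree enters the
  -- count of sides.
  have hreg : ∀ f, M.region F f = M.region F b → f = b := by
    intro f hf
    let q : M.Region F → Prop := Quot.lift (fun f => f = b) (by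
      rintro _ _ ⟨h, hh, rfl, rfl⟩
      simp only [eq_iff_iff]
      constructor
      · intro h1
        exact absurd (hb h h1).1 hh
      · intro h1
        exact absurd (hb (M.opp h) h1).1 (by simpa using hh))
    have : q (M.region F f) = q (M.region F b) := by rw [hf]
    have hqf : (f = b) = (b = b) := this
    simpa using hqf
  have hne : M.region F (M.leftFace b.out) ≠ M.region F b := fun h => hb1.2 (hreg _ h)
  have hdeg : {h | M.edge h ∈ F ∧ M.region F (M.leftFace h) = M.region F b}.ncard
      = M.faceDegree b := by
    rw [faceDegree, ← Set.coe_ofPred, Nat.card_coe_set_eq]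
    refine Set.ncard_congr (fun h _ => M.opp h) ?_ (fun _ _ _ _ e => M.opp_injective e) ?_
    · rintro h ⟨-, hh⟩
      exact hreg _ hh
    · intro h hh
      exact ⟨M.opp h, ⟨by simpa using (hb h hh).1, by
        simpa using congrArg (M.region F) hh⟩, by simp⟩
  have hsum := sum_ncard_sides F
  rw [← Finset.add_sum_erase _ _ (Finset.mem_univ (M.region F b)), hdeg] at hsum
  have h2 := Finset.card_nsmul_le_sum (Finset.univ.erase (M.region F b))
    (fun C => {h | M.edge h ∈ F ∧ M.region F (M.leftFace h) = C}.ncard) (e + 2) (by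
      intro D hD
      exact le_ncard_sides hg F D _ (Finset.ne_of_mem_erase hD).symm)
  rw [Finset.card_erase_of_mem (Finset.mem_univ _), Finset.card_univ, ← Nat.card_eq_fintype_card,
    smul_eq_mul] at h2
  obtain ⟨k, hk⟩ : ∃ k, Nat.card (M.Region F) = k + 1 :=
    ⟨_, (Nat.succ_pred_eq_of_pos (Nat.card_pos_iff.2 ⟨⟨M.region F b⟩, inferInstance⟩)).symm⟩
  rw [hk] at h1 h2
  simp only [Nat.add_sub_cancel] at h2
  nlinarith

end Counting

end PlanarMap

/-! ### The contour of the boundary face. -/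

lemma fin_forall_of_add_one {n : ℕ} [NeZero n] {P : Fin n → Prop} {i : Fin n} (hi : P i)
    (step : ∀ j, P j → P (j + 1)) (j : Fin n) : P j := by
  have h : ∀ m : ℕ, P (i + (Fin.ofNat n m)) := by
    intro m
    induction m with
    | zero => simpa using hi
    | succ m ih =>
      have := step _ ih
      rw [add_assoc] at this
      convert this using 2
      ext
      simp [Fin.val_add]
  have := h (j - i : Fin n)
  rwa [Fin.ofNat_val_eq_self, add_sub_cancel] at this

namespace AnnularAngulation

open PlanarMap

variable {H : Type*} [Fintype H] {p d : ℕ} (A : AnnularAngulation H p d)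

lemma ncard_boundary : {h | A.rightFace h = A.boundary}.ncard = p := by
  refine Eq.trans ?_ A.degree_boundary
  rw [faceDegree, ← Set.coe_ofPred, Nat.card_coe_set_eq]

/-- With the boundary face on both sides of `h`, the simple contour makes `rot` fix both halves. The
map is then a single edge, and the boundary degree is at most 2. -/
lemma leftFace_ne_boundary (hp : 3 ≤ p) {h : H} (hh : A.rightFace h = A.boundary) :
    A.leftFace h ≠ A.boundary := by
  intro hl
  have e1 : A.rot (A.opp h) = A.opp h :=
    A.simple_boundary _ _ (by simpa using hh) (by simpa using hl) (by simp)
  have e2 : A.rot h = h := A.simple_boundary _ _ (by simpa using hl) hh (by simp)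
  have hall : ∀ k, k = h ∨ k = A.opp h := by
    intro k
    have := A.apply_eq_apply_of_connected (fun x => x = h ∨ x = A.opp h) (by
      intro x
      rw [← e2, A.rot.injective.eq_iff, e2]
      nth_rw 1 [← e1]
      rw [A.rot.injective.eq_iff]) (by
      intro x
      rw [A.opp_injective.eq_iff, ← A.opp_injective.eq_iff (a := A.opp x), A.opp_opp_apply]
      exact propext or_comm) k h
    rw [this]
    exact Or.inl rfl
  have h3 := A.ncard_boundary
  have h4 := Set.ncard_le_ncard (s := {h | A.rightFace h = A.boundary}) (t := {h, A.opp h})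
    (fun k _ => hall k) (Set.toFinite _)
  have h5 := Set.ncard_insert_le h {A.opp h}
  rw [Set.ncard_singleton] at h5
  omega

lemma eq_rot_opp {h k : H} (hh : A.rightFace h = A.boundary) (hk : A.rightFace k = A.boundary)
    (e : A.source k = A.target h) : k = A.rot (A.opp h) :=
  A.simple_boundary _ _ hk (by simpa using hh) (by simpa using e)

/-- The contour of the boundary face, followed with the boundary face on the right. -/
lemma exists_boundary_cycle : ∃ c : A.SimpleCycle, (∀ i, A.rightFace (c.dart i) = A.boundary) ∧
    ∀ h, A.rightFace h = A.boundary → ∃ i, c.dart i = h := by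
  obtain ⟨c, hc⟩ := exists_simpleCycle_of_faces (M := A.toPlanarMap) (S := {A.boundary}ᶜ)
    (f := A.root) (g := A.boundary) A.root_ne_boundary (by simp)
  have hr : ∀ i, A.rightFace (c.dart i) = A.boundary := fun i => by simpa using (hc i).2
  refine ⟨c, hr, fun h hh => ?_⟩
  refine perm_induction (A.rightFace_eq_iff.1 ((hr 0).trans hh.symm))
    (P := fun x => ∃ i, c.dart i = x) ⟨0, rfl⟩ ?_
  rintro _ ⟨i, rfl⟩
  exact ⟨i + 1, A.eq_rot_opp (hr i) (hr (i + 1)) (c.closed i).symm⟩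

/-- The boundary face together with the faces on the left of `c` is closed under crossing edges, so
it is everything. -/
lemma clockwise_of_boundary (c : A.SimpleCycle) (hc : ∀ i, A.rightFace (c.dart i) = A.boundary)
    (hc' : ∀ h, A.rightFace h = A.boundary → ∃ i, c.dart i = h) : c.Clockwise A.root := by
  have step : ∀ h, (A.rightFace h = A.boundary ∨ c.FaceOnLeft (A.rightFace h)) →
      (A.leftFace h = A.boundary ∨ c.FaceOnLeft (A.leftFace h)) := by
    intro h hh
    by_cases hb : A.rightFace h = A.boundary
    · obtain ⟨i, rfl⟩ := hc' h hb
      exact Or.inr ⟨i, .refl⟩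
    · obtain ⟨i, hi⟩ := hh.resolve_left hb
      by_cases he : c.HasEdge (A.edge h)
      · obtain ⟨j, hj⟩ := he
        rcases A.edge_eq_iff.1 hj with e | e
        · exact absurd (e ▸ hc j) hb
        · left
          rw [e, leftFace_opp, hc]
      · exact Or.inr ⟨i, hi.tail ⟨h, he, rfl, rfl⟩⟩
  have hall := A.face_apply_eq (fun f => f = A.boundary ∨ c.FaceOnLeft f) (fun h => propext
    ⟨fun h1 => by simpa using step (A.opp h) (by simpa using h1), step h⟩) A.boundary A.root
  have : A.root = A.boundary ∨ c.FaceOnLeft A.root := hall ▸ Or.inl rfl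
  exact this.resolve_left A.root_ne_boundary

/-- Clockwise means followed with the boundary face on the right: in the other direction this face
would be alone on the left, without the root-face. The circuit condition thus becomes a local
condition on half-edges. -/
lemma isPseudoOrientation_iff (hp : 3 ≤ p) (O : A.NBiorientation) : A.IsPseudoOrientation O ↔
    (∀ h, O.edgeWeight h = d - 2) ∧ (∀ v, ¬ A.BoundaryVertex v → O.vertexWeight v = d) ∧
      ∀ h, A.rightFace h = A.boundary → h ∉ O.ingoing ∧ A.opp h ∈ O.ingoing := by
  constructor
  · rintro ⟨he, hv, c, hce, hcirc, hclock, hone⟩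
    refine ⟨he, hv, ?_⟩
    have hside : ∀ i, A.rightFace (c.dart i) = A.boundary ∨ A.leftFace (c.dart i) = A.boundary := by
      intro i
      obtain ⟨h, hh, e⟩ := (hce _).1 ⟨i, rfl⟩
      rcases A.edge_eq_iff.1 e with e | e
      · exact Or.inl (e ▸ hh)
      · right
        rw [e, leftFace_opp, hh]
    have hright : ∀ i, A.rightFace (c.dart i) = A.boundary := by
      by_contra hcon
      push Not at hcon
      obtain ⟨i, hi⟩ := hcon
      -- The side of the boundary face cannot change along `c`: by simplicity of the contour, the
      -- next dart would be the reverse of the current one.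
      have hleft : ∀ j, A.leftFace (c.dart j) = A.boundary := by
        refine fin_forall_of_add_one ((hside i).resolve_left hi) fun j hj => ?_
        by_contra hn
        have e : c.dart (j + 1) = A.opp (c.dart j) :=
          A.simple_boundary _ _ ((hside (j + 1)).resolve_right hn) hj (c.closed j).symm
        have := c.edge_injective (a₁ := j + 1) (a₂ := j) (by simp [e])
        rw [this] at e
        exact A.opp_ne _ e.symm
      obtain ⟨j, hj⟩ := hclock
      rw [hleft j] at hj
      rcases Relation.ReflTransGen.cases_head hj with e | ⟨_, ⟨h, hh, hb, -⟩, -⟩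
      · exact A.root_ne_boundary e.symm
      · exact hh ((hce _).2 ⟨h, hb, rfl⟩)
    intro h hh
    obtain ⟨i, hi⟩ := (hce (A.edge h)).2 ⟨h, hh, rfl⟩
    have e : c.dart i = h := by
      rcases A.edge_eq_iff.1 hi.symm with e | e
      · exact e
      · have := hright i
        rw [e] at this
        exact absurd this (A.leftFace_ne_boundary hp hh)
    subst e
    have h1 : A.opp (c.dart i) ∈ O.ingoing := hcirc i
    refine ⟨fun h2 => ?_, h1⟩
    rcases hone i with h3 | h3
    · exact h3.2 h1
    · exact h3.2 h2
  · rintro ⟨he, hv, hb⟩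
    obtain ⟨c, hc, hc'⟩ := A.exists_boundary_cycle
    refine ⟨he, hv, c, fun e => ⟨?_, ?_⟩, fun i => (hb _ (hc i)).2, A.clockwise_of_boundary c hc hc',
      fun i => Or.inr ⟨(hb _ (hc i)).2, (hb _ (hc i)).1⟩⟩
    · rintro ⟨i, rfl⟩
      exact ⟨_, hc i, rfl⟩
    · rintro ⟨h, hh, rfl⟩
      obtain ⟨i, rfl⟩ := hc' h hh
      exact ⟨i, rfl⟩

/-- The non-boundary faces are connected off the boundary edges. -/
lemma face_apply_eq_root {R : Type*} [AddCommGroup R] (hp : 3 ≤ p) (q : A.Face → R)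
    (hq : ∀ h, A.rightFace h ≠ A.boundary → A.leftFace h ≠ A.boundary →
      q (A.leftFace h) = q (A.rightFace h)) (f : A.Face) (hf : f ≠ A.boundary) :
    q f = q A.root := by
  classical
  have hstep : ∀ h, A.rightFace h = A.boundary →
      q (A.leftFace (A.rot (A.opp h))) = q (A.leftFace h) := by
    intro h hh
    have hk : A.rightFace (A.rot (A.opp h)) = A.boundary := by simpa using hh
    have hne : A.rot (A.opp h) ≠ A.opp h := by
      intro e
      rw [e] at hk
      exact A.leftFace_ne_boundary hp hh hk
    -- At a boundary vertex the curl of `q` lives on the two contour edges only, so its conservation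
    -- carries the value of `q` from one face along the contour to the next.
    have hs := A.sum_curl_eq_zero q (A.target h)
    rw [← Finset.sum_subset (s₁ := {A.rot (A.opp h), A.opp h}), Finset.sum_pair hne, hk,
      leftFace_opp, rightFace_opp, hh] at hs
    · rw [← sub_eq_zero, ← hs]
      abel
    · intro x hx
      rw [Finset.mem_insert, Finset.mem_singleton] at hx
      rcases hx with rfl | rfl <;> simp
    · intro x hx hx'
      rw [Finset.mem_filter] at hx
      rw [Finset.mem_insert, Finset.mem_singleton, not_or] at hx'
      rw [sub_eq_zero]
      refine hq x (fun hr => hx'.1 (A.eq_rot_opp hh hr hx.2)) fun hl => hx'.2 ?_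
      have := A.eq_rot_opp (k := A.rot x) hh (by simpa using hl) (by simpa using hx.2)
      exact A.rot.injective this
  have hconst : ∀ h, A.rightFace h = A.boundary →
      q (A.leftFace h) = q (A.leftFace A.boundary.out) := by
    intro h hh
    refine (perm_induction (A.rightFace_eq_iff.1
      ((A.rightFace_out_eq A.boundary).trans hh.symm))
      (P := fun x => A.rightFace x = A.boundary ∧
        q (A.leftFace x) = q (A.leftFace A.boundary.out)) ⟨by simp, rfl⟩ ?_).2
    rintro x ⟨hx, e⟩
    simp only [Equiv.Perm.mul_apply, rightFace_rot_opp, hx, true_and]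
    rw [hstep x hx, e]
  have step : ∀ h, (A.rightFace h = A.boundary ∨
      q (A.rightFace h) = q (A.leftFace A.boundary.out)) →
      (A.leftFace h = A.boundary ∨ q (A.leftFace h) = q (A.leftFace A.boundary.out)) := by
    intro h hh
    by_cases hb : A.rightFace h = A.boundary
    · exact Or.inr (hconst h hb)
    · by_cases hl : A.leftFace h = A.boundary
      · exact Or.inl hl
      · right
        rw [hq h hb hl, hh.resolve_left hb]
  have hall := A.face_apply_eq (fun f => f = A.boundary ∨ q f = q (A.leftFace A.boundary.out))
    (fun h => propext
      ⟨fun h1 => by simpa using step (A.opp h) (by simpa using h1), step h⟩) A.boundary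
  have h1 : f = A.boundary ∨ q f = q (A.leftFace A.boundary.out) := hall f ▸ Or.inl rfl
  have h2 : A.root = A.boundary ∨ q A.root = q (A.leftFace A.boundary.out) :=
    hall A.root ▸ Or.inl rfl
  rw [h1.resolve_left hf, h2.resolve_left A.root_ne_boundary]

end AnnularAngulation

/-! ### Total weights over sets of vertices and edges. -/

namespace PlanarMap.NBiorientation

variable {H : Type*} [Fintype H] {M : PlanarMap H} (O : M.NBiorientation)

lemma mem_ingoing_iff (h : H) : h ∈ O.ingoing ↔ 0 < O.weight h := by
  refine ⟨O.weight_pos h, fun hh => ?_⟩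
  by_contra hn
  have := O.weight_nonpos h hn
  omega

open Classical in
lemma vertexWeight_eq (v : M.Vertex) : O.vertexWeight v = ∑ h with M.source h = v, O.weight h := by
  rw [vertexWeight, ← Finset.filter_filter]
  refine Finset.sum_filter_of_ne fun h _ hh => ?_
  rw [mem_ingoing_iff]
  omega

open Classical in
lemma sum_weight_of_vertexWeight {m : ℕ} (X : Set M.Vertex) (hX : ∀ v ∈ X, O.vertexWeight v = m) :
    ∑ h with M.source h ∈ X, O.weight h = m * X.ncard := by
  rw [Set.ncard_eq_toFinset_card', mul_comm, ← smul_eq_mul, ← Finset.sum_const,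
    ← Finset.sum_fiberwise_of_maps_to (g := M.source) (t := X.toFinset) (by simp)]
  refine Finset.sum_congr rfl fun v hv => ?_
  rw [Set.mem_toFinset] at hv
  rw [← hX v hv, vertexWeight_eq, Finset.filter_filter]
  refine Finset.sum_congr ?_ fun _ _ => rfl
  ext h
  simp only [Finset.mem_filter, Finset.mem_univ, true_and, and_iff_right_iff_imp]
  rintro rfl
  exact hv

open Classical in
lemma sum_weight_of_edgeWeight {m : ℕ} (hO : ∀ h, O.edgeWeight h = m) (F : Set M.Edge) :
    ∑ h with M.edge h ∈ F, O.weight h = m * F.ncard := by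
  rw [Finset.sum_filter, M.sum_eq_sum_edge, Set.ncard_eq_toFinset_card', mul_comm, ← smul_eq_mul,
    ← Finset.sum_const]
  simp only [edge_out_eq, edge_opp]
  rw [← Finset.sum_subset (Finset.subset_univ F.toFinset)]
  · refine Finset.sum_congr rfl fun e he => ?_
    rw [Set.mem_toFinset] at he
    simp only [he, if_true]
    exact hO e.out
  · intro e _ he
    rw [Set.mem_toFinset] at he
    simp [he]

end PlanarMap.NBiorientation

/-! ### Girth and accessibility from a pseudo-orientation, by counting. -/

namespace AnnularAngulation

open PlanarMap

variable {H : Type*} [Fintype H] {p d : ℕ} (A : AnnularAngulation H p d)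

lemma ncard_darts (S : Set A.Face) (hS : A.boundary ∉ S) :
    {h | A.rightFace h ∈ S}.ncard = d * S.ncard := by
  classical
  rw [Set.ncard_eq_toFinset_card', Set.ncard_eq_toFinset_card', mul_comm, ← smul_eq_mul,
    ← Finset.sum_const, Finset.card_eq_sum_card_fiberwise (f := A.rightFace) (t := S.toFinset)
      (by intro h; simp)]
  refine Finset.sum_congr rfl fun f hf => ?_
  rw [Set.mem_toFinset] at hf
  refine Eq.trans ?_ (A.degree_other f (fun e => hS (e ▸ hf)))
  rw [faceDegree, Nat.card_eq_fintype_card, Fintype.card_subtype]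
  congr 1
  ext h
  simp only [Set.mem_toFinset, Set.mem_ofPred_eq, Finset.mem_filter, Finset.mem_univ, true_and,
    and_iff_right_iff_imp]
  rintro rfl
  exact hf

lemma two_mul_card_edge_add : 2 * Nat.card A.Edge + d = p + d * Nat.card A.Face := by
  have h1 := A.ncard_darts {A.boundary}ᶜ (by simp)
  have h2 := A.ncard_boundary
  have h3 := ncard_halves (M := A.toPlanarMap) Set.univ
  have h4 := Set.ncard_add_ncard_compl {h | A.rightFace h = A.boundary}
  have h5 := Set.ncard_add_ncard_compl {A.boundary}
  rw [Set.ncard_singleton] at h5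
  simp only [Set.mem_univ, Set.ofPred_true, Set.ncard_univ] at h3
  have h6 : {h | A.rightFace h = A.boundary}ᶜ.ncard = {h | A.rightFace h ∈ ({A.boundary}ᶜ : Set A.Face)}.ncard := rfl
  rw [← h5]
  have : d * (1 + ({A.boundary}ᶜ : Set A.Face).ncard) = d + d * ({A.boundary}ᶜ : Set A.Face).ncard := by ring
  omega

/-- The cut around the root-face contains a simple cycle, made of at most `d` sides of that face. -/
lemma exists_simpleCycle_len_le : ∃ c : A.SimpleCycle, c.len ≤ d := by
  obtain ⟨c, hc⟩ := exists_simpleCycle_of_faces (M := A.toPlanarMap) (S := {A.root})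
    (f := A.root) (g := A.boundary) rfl A.root_ne_boundary.symm
  refine ⟨c, ?_⟩
  have hinj : Function.Injective fun i => A.opp (c.dart i) :=
    fun i j e => c.edge_injective (congrArg A.edge (A.opp_injective e))
  have h1 := Set.ncard_le_ncard (s := Set.range fun i => A.opp (c.dart i))
    (t := {h | A.rightFace h ∈ ({A.root} : Set A.Face)}) (by
      rintro _ ⟨i, rfl⟩
      exact (hc i).1) (Set.toFinite _)
  rwa [Set.ncard_range_of_injective hinj, Nat.card_fin,
    A.ncard_darts _ (by simpa using A.root_ne_boundary.symm), Set.ncard_singleton, mul_one] at h1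

/-- On the side of `c` away from the boundary face, let there be `t` faces, `m` inner edges and `n`
inner vertices. Then `m + 1 ≤ t + n` by Euler, `d t ≤ 2 m + c.len` by counting sides and `d n ≤ (d -
2) m` by weights. Multiplying the first by `d` gives the result. -/
lemma le_len_of_isPseudoOrientation (hd : 2 ≤ d) (O : A.NBiorientation)
    (hO : A.IsPseudoOrientation O) (c : A.SimpleCycle) : d ≤ c.len := by
  classical
  obtain ⟨q, hq, hq'⟩ := c.exists_separating_potential
  set T : Set A.Face := {f | Relation.ReflTransGen c.AdjOff A.boundary f} with hT
  have hqT : ∀ f ∈ T, q f = q A.boundary := by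
    intro f hf
    induction (hf : Relation.ReflTransGen c.AdjOff A.boundary f) with
    | refl => rfl
    | tail _ h ih =>
      obtain ⟨h, hh, rfl, rfl⟩ := h
      rw [hq' h hh]
      exact ih
  have hb : A.boundary ∈ T := .refl
  have hoff : ∀ h, ¬ c.HasEdge (A.edge h) → A.rightFace h ∈ T → A.leftFace h ∈ T :=
    fun h h1 h2 => .tail h2 ⟨h, h1, rfl, rfl⟩
  -- The separating potential is constant on `T` but jumps across `c`.
  obtain ⟨f₀, hf₀⟩ : ∃ f, f ∉ T := by
    by_contra hcon
    push Not at hcon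
    have := hq 0
    rw [hqT _ (hcon _), hqT _ (hcon (A.rightFace _))] at this
    linarith
  have heuler := ncard_inner_edges_lt T A.boundary f₀ hb hf₀ (by
    intro f hf
    induction (hf : Relation.ReflTransGen c.AdjOff A.boundary f) with
    | refl => exact .refl
    | tail h1 h2 ih =>
      obtain ⟨h, hh, hr, hl⟩ := h2
      exact ih.tail ⟨h1, h1.tail ⟨h, hh, hr, hl⟩, h, hr, hl⟩)
  set In : Set A.Edge := {e | ∀ h, A.edge h = e → A.rightFace h ∉ T} with hIn
  set Iv : Set A.Vertex := {v | ∀ h, A.source h = v → A.rightFace h ∉ T} with hIv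
  have hmem : ∀ h, A.edge h ∈ In ↔ A.rightFace h ∉ T ∧ A.leftFace h ∉ T := by
    intro h
    refine ⟨fun hh => ⟨hh h rfl, hh (A.opp h) (by simp)⟩, fun hh k hk => ?_⟩
    rcases A.edge_eq_iff.1 hk with rfl | rfl
    · exact hh.1
    · simpa using hh.2
  have hfaces : d * Tᶜ.ncard ≤ 2 * In.ncard + c.len := by
    rw [← A.ncard_darts Tᶜ (by simpa using hb), ← ncard_halves]
    have hsub : {h | A.rightFace h ∈ Tᶜ} ⊆ {h | A.edge h ∈ In} ∪
        {h | A.rightFace h ∉ T ∧ A.leftFace h ∈ T} := by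
      intro h hh
      by_cases hl : A.leftFace h ∈ T
      · exact Or.inr ⟨hh, hl⟩
      · exact Or.inl ((hmem h).2 ⟨hh, hl⟩)
    refine (Set.ncard_le_ncard hsub (Set.toFinite _)).trans ((Set.ncard_union_le _ _).trans ?_)
    gcongr
    have hcl : (Set.range fun i => A.edge (c.dart i)).ncard = c.len := by
      rw [Set.ncard_range_of_injective c.edge_injective, Nat.card_fin]
    rw [← hcl]
    refine Set.ncard_le_ncard_of_injOn A.edge ?_ ?_ (Set.toFinite _)
    · rintro h ⟨hr, hl⟩
      by_contra hn
      exact hr (by simpa using hoff (A.opp h) (by rwa [A.edge_opp]) (by simpa using hl))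
    · rintro h ⟨hr, hl⟩ k ⟨hr', hl'⟩ e
      rcases A.edge_eq_iff.1 e with rfl | rfl
      · rfl
      · exact absurd hl hr'
  have hweight : d * Iv.ncard ≤ (d - 2) * In.ncard := by
    rw [← O.sum_weight_of_vertexWeight Iv fun v hv => hO.vertex_weight v ?_,
      ← O.sum_weight_of_edgeWeight hO.edge_weight In]
    · refine Finset.sum_le_sum_of_subset fun h hh => ?_
      simp only [Finset.mem_filter, Finset.mem_univ, true_and] at hh ⊢
      rw [hmem]
      have h2 := hh (A.rot h) (by simp)
      rw [rightFace_rot] at h2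
      exact ⟨hh h rfl, h2⟩
    · rintro ⟨h, h1, h2⟩
      exact hv h h2 (h1 ▸ hb)
  obtain ⟨e, rfl⟩ : ∃ e, d = e + 2 := ⟨d - 2, by omega⟩
  simp only [Nat.add_sub_cancel] at hweight
  nlinarith

/-- The set `X` of unreachable vertices avoids the boundary, whose contour is a directed circuit. An
edge ingoing at a vertex of `X` has its other end in `X` too, so the weight `d|X|` comes from edges
inside `X`, which are too few by sparsity. -/
lemma accessibleFrom_of_boundaryVertex (hd : 3 ≤ d) (hdp : d ≤ p)
    (hg : ∀ c : A.SimpleCycle, d ≤ c.len) (O : A.NBiorientation)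
    (hO : A.IsPseudoOrientation O) (v : A.Vertex) (hv : A.BoundaryVertex v) :
    O.AccessibleFrom v := by
  classical
  have hO' := (A.isPseudoOrientation_iff (by omega) O).1 hO
  let R : A.Vertex → A.Vertex → Prop :=
    fun a b => ∃ h, O.Traversable h ∧ A.source h = a ∧ A.target h = b
  change ∀ u, Relation.ReflTransGen R v u
  by_contra hcon
  push Not at hcon
  obtain ⟨u, hu⟩ := hcon
  set X : Set A.Vertex := {u | ¬ Relation.ReflTransGen R v u} with hX
  have hXb : ∀ x ∈ X, ¬ A.BoundaryVertex x := by
    rintro _ hx ⟨k, hk, rfl⟩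
    obtain ⟨h, hh, rfl⟩ := hv
    refine hx (perm_induction (A.rightFace_eq_iff.1 (hh.trans hk.symm))
      (P := fun x => A.rightFace x = A.boundary ∧ Relation.ReflTransGen R (A.source h) (A.source x))
      ⟨hh, .refl⟩ ?_).2
    rintro x ⟨hx, hr⟩
    refine ⟨by simpa using hx, hr.tail ⟨x, (hO'.2.2 x hx).2, rfl, by simp⟩⟩
  let F : Set A.Edge := {e | ∀ h, A.edge h = e → A.source h ∈ X}
  have h1 := sparse_of_girth hd hg F X ⟨u, hu⟩ fun h hh => hh h rfl
  have h2 := O.sum_weight_of_vertexWeight X fun x hx => hO.vertex_weight x (hXb x hx)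
  have h3 := O.sum_weight_of_edgeWeight hO.edge_weight F
  rw [← h2, ← h3] at h1
  refine absurd h1 (not_lt.2 ?_)
  refine Finset.sum_le_sum_of_ne_zero fun h hh hw => ?_
  simp only [Finset.mem_filter, Finset.mem_univ, true_and] at hh ⊢
  have ht : A.target h ∈ X := by
    intro hr
    refine hh (hr.tail ⟨A.opp h, ?_, rfl, by simp⟩)
    change A.opp (A.opp h) ∈ O.ingoing
    rw [A.opp_opp, O.mem_ingoing_iff]
    omega
  intro k hk
  rcases A.edge_eq_iff.1 hk with rfl | rfl
  · exact hh
  · simpa using ht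

end AnnularAngulation

/-! ### Existence, by Hall's marriage theorem. -/

namespace AnnularAngulation

open PlanarMap

variable {H : Type*} [Fintype H] {p d : ℕ} (A : AnnularAngulation H p d)

lemma edgeOnFace_boundary_iff (h : H) : A.EdgeOnFace (A.edge h) A.boundary ↔
    A.rightFace h = A.boundary ∨ A.leftFace h = A.boundary := by
  constructor
  · rintro ⟨k, hk, e⟩
    rcases A.edge_eq_iff.1 e with rfl | rfl
    · exact Or.inl hk
    · exact Or.inr (by simpa using hk)
  · rintro (hh | hh)
    · exact ⟨h, hh, rfl⟩
    · exact ⟨A.opp h, hh, by simp⟩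

lemma ncard_boundary_edges (hp : 3 ≤ p) : {e | A.EdgeOnFace e A.boundary}.ncard = p := by
  refine Eq.trans (Set.ncard_congr (fun h _ => A.edge h) ?_ ?_ ?_).symm A.ncard_boundary
  · intro h hh
    exact ⟨h, hh, rfl⟩
  · intro h k hh hk e
    rcases A.edge_eq_iff.1 e with rfl | rfl
    · rfl
    · exact absurd hk (A.leftFace_ne_boundary hp hh)
  · rintro _ ⟨h, hh, rfl⟩
    exact ⟨h, hh, rfl⟩

lemma ncard_boundary_vertices : {v | A.BoundaryVertex v}.ncard = p := by
  refine Eq.trans (Set.ncard_congr (fun h _ => A.source h) ?_ ?_ ?_).symm A.ncard_boundary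
  · intro h hh
    exact ⟨h, hh, rfl⟩
  · intro h k hh hk e
    exact A.simple_boundary h k hh hk e
  · rintro _ ⟨h, hh, rfl⟩
    exact ⟨h, hh, rfl⟩

/-- The double counting behind the definition of pseudo-orientations. -/
lemma card_inner_edges_mul (hd : 2 ≤ d) (hdp : d ≤ p) (hp : 3 ≤ p) :
    {e | A.EdgeOnFace e A.boundary}ᶜ.ncard * (d - 2)
      = {v | A.BoundaryVertex v}ᶜ.ncard * d + (p - d) := by
  have h1 := A.two_mul_card_edge_add
  have h2 := A.euler_card
  have h3 := Set.ncard_add_ncard_compl {e | A.EdgeOnFace e A.boundary}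
  have h4 := Set.ncard_add_ncard_compl {v | A.BoundaryVertex v}
  rw [A.ncard_boundary_edges hp] at h3
  rw [A.ncard_boundary_vertices] at h4
  rw [← h3] at h1 h2
  rw [← h4] at h2
  obtain ⟨e, he⟩ : ∃ e, d = e + 2 := ⟨d - 2, by omega⟩
  obtain ⟨k, hk⟩ : ∃ k, p = d + k := ⟨p - d, by omega⟩
  rw [show p - d = k by omega, show d - 2 = e by omega]
  generalize {e | A.EdgeOnFace e A.boundary}ᶜ.ncard = x at *
  generalize {v | A.BoundaryVertex v}ᶜ.ncard = y at *
  generalize Nat.card A.Face = z at *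
  zify at *
  have hz : (z : ℤ) = x + 2 - y := by linarith
  rw [hz, hk, he] at h1
  rw [he]
  linarith

/-- In girth at least `d`, sets of inner edges are sparse, up to the weight `p - d` left for the
boundary vertices. -/
lemma ncard_mul_le_of_girth (hd : 3 ≤ d) (hdp : d ≤ p) (hg : ∀ c : A.SimpleCycle, d ≤ c.len)
    (F : Set A.Edge) (hF : ∀ e ∈ F, ¬ A.EdgeOnFace e A.boundary) :
    (d - 2) * F.ncard ≤
      d * {v | ¬ A.BoundaryVertex v ∧ ∃ h, A.edge h ∈ F ∧ A.source h = v}.ncard + (p - d) := by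
  have hp : 3 ≤ p := by omega
  set X := {v | ¬ A.BoundaryVertex v ∧ ∃ h, A.edge h ∈ F ∧ A.source h = v} with hX
  -- The contour brings `p` edges and `p` vertices, so `d * p - (d - 2) * p - d - p = p - d` is left
  -- over.
  have h1 := sparse_of_girth_of_face hd hg (F ∪ {e | A.EdgeOnFace e A.boundary})
    (X ∪ {v | A.BoundaryVertex v}) A.boundary
    (fun h hh => ⟨Or.inr ⟨h, hh, rfl⟩, A.leftFace_ne_boundary hp hh⟩) (by
      intro h hh
      by_cases hv : A.BoundaryVertex (A.source h)
      · exact Or.inr hv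
      · rcases hh with hh | hh
        · exact Or.inl ⟨hv, h, hh, rfl⟩
        · rcases (A.edgeOnFace_boundary_iff h).1 hh with hh | hh
          · exact absurd ⟨h, hh, rfl⟩ hv
          · exact absurd ⟨A.rot h, by simpa using hh, by simp⟩ hv)
  have hdF : Disjoint F {e | A.EdgeOnFace e A.boundary} :=
    Set.disjoint_left.2 fun e he he' => hF e he he'
  have hdX : Disjoint X {v | A.BoundaryVertex v} := Set.disjoint_left.2 fun v hv hv' => hv.1 hv'
  rw [Set.ncard_union_eq hdF, Set.ncard_union_eq hdX,
    A.ncard_boundary_edges hp, A.ncard_boundary_vertices] at h1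
  have h2 : A.faceDegree A.boundary = p := A.degree_boundary
  rw [h2] at h1
  obtain ⟨e, he⟩ : ∃ e, d = e + 2 := ⟨d - 2, by omega⟩
  obtain ⟨k, hk⟩ : ∃ k, p = d + k := ⟨p - d, by omega⟩
  rw [show p - d = k by omega]
  rw [show d - 2 = e by omega] at h1 ⊢
  generalize F.ncard = x at h1 ⊢
  generalize X.ncard = y at h1 ⊢
  rw [hk, he] at h1
  rw [he]
  nlinarith

/-- A distribution of the weight `d - 2` of each inner edge among its two halves, in which each
inner vertex receives the weight `d`. -/
lemma exists_distribution (hd : 3 ≤ d) (hdp : d ≤ p) (hg : ∀ c : A.SimpleCycle, d ≤ c.len) :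
    ∃ w : H → ℕ, (∀ h, ¬ A.EdgeOnFace (A.edge h) A.boundary → w h + w (A.opp h) = d - 2) ∧
      ∀ v, ¬ A.BoundaryVertex v → (open Classical in ∑ h with A.source h = v, w h) = d := by
  classical
  have hp : 3 ≤ p := by omega
  let E' := {e // ¬ A.EdgeOnFace e A.boundary}
  let U := {v // ¬ A.BoundaryVertex v}
  -- Slots for units of weight: `d` for each inner vertex, and `p - d` shared by all boundary
  -- vertices. The `d - 2` units of an inner edge may go to the slots of its ends.
  let good : (U × Fin d) ⊕ Fin (p - d) → A.Vertex → Prop := fun s v =>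
    Sum.elim (fun x => x.1.1 = v) (fun _ => A.BoundaryVertex v) s
  let t : E' × Fin (d - 2) → Finset ((U × Fin d) ⊕ Fin (p - d)) := fun x =>
    Finset.univ.filter fun s => ∃ h, A.edge h = x.1.1 ∧ good s (A.source h)
  have hall : ∀ s : Finset (E' × Fin (d - 2)), s.card ≤ (s.biUnion t).card := by
    intro s
    rcases s.eq_empty_or_nonempty with rfl | ⟨x₀, hx₀⟩
    · simp
    let F : Set A.Edge := {e | ∃ x ∈ s, x.1.1 = e}
    have hFc : F.ncard = (s.image Prod.fst).card := by
      rw [← Finset.card_image_of_injective _ Subtype.val_injective, ← Set.ncard_coe_finset]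
      congr 1
      ext e
      simp only [Finset.coe_image, Set.image_image]
      rfl
    have hs : s.card ≤ (d - 2) * F.ncard := by
      rw [hFc, mul_comm]
      calc s.card ≤ (s.image Prod.fst ×ˢ (Finset.univ : Finset (Fin (d - 2)))).card :=
            Finset.card_le_card fun x hx => by
              simp only [Finset.mem_product, Finset.mem_univ, and_true]
              exact Finset.mem_image_of_mem _ hx
        _ = _ := by simp [Finset.card_product]
    let XU : Finset U := Finset.univ.filter fun u => ∃ h, A.edge h ∈ F ∧ A.source h = u.1
    have hXc : {v | ¬ A.BoundaryVertex v ∧ ∃ h, A.edge h ∈ F ∧ A.source h = v}.ncard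
        = XU.card := by
      rw [← Finset.card_image_of_injective _ Subtype.val_injective, ← Set.ncard_coe_finset]
      congr 1
      ext v
      simp only [Set.mem_ofPred_eq, Finset.coe_image, Set.mem_image, XU, Finset.coe_filter,
        Finset.mem_univ, true_and]
      exact ⟨fun h => ⟨⟨v, h.1⟩, h.2, rfl⟩, fun ⟨u, h, e⟩ => e ▸ ⟨u.2, h⟩⟩
    have hF : ∀ e ∈ F, ¬ A.EdgeOnFace e A.boundary := by
      rintro _ ⟨x, -, rfl⟩
      exact x.1.2
    have hin : ∀ u ∈ XU, ∀ j, Sum.inl (u, j) ∈ s.biUnion t := by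
      intro u hu j
      obtain ⟨h, ⟨x, hx, hxe⟩, hh⟩ := (Finset.mem_filter.1 hu).2
      exact Finset.mem_biUnion.2 ⟨x, hx, Finset.mem_filter.2
        ⟨Finset.mem_univ _, h, hxe.symm, hh.symm⟩⟩
    -- If an edge of `F` meets the boundary then all shared slots are available; otherwise none is,
    -- and the strict sparsity bound already suffices.
    by_cases hb : ∃ h, A.edge h ∈ F ∧ A.BoundaryVertex (A.source h)
    · have h1 := A.ncard_mul_le_of_girth hd hdp hg F hF
      rw [hXc] at h1
      refine (hs.trans h1).trans ?_
      have hsub : (XU ×ˢ (Finset.univ : Finset (Fin d))).disjSum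
          (Finset.univ : Finset (Fin (p - d))) ⊆ s.biUnion t := by
        intro x hx
        rcases x with ⟨u, j⟩ | j
        · exact hin u (by simpa using hx) j
        · obtain ⟨h, ⟨x, hx, hxe⟩, hh⟩ := hb
          exact Finset.mem_biUnion.2 ⟨x, hx, Finset.mem_filter.2
            ⟨Finset.mem_univ _, h, hxe.symm, hh⟩⟩
      have := Finset.card_le_card hsub
      rwa [Finset.card_disjSum, Finset.card_product, Finset.card_fin, Finset.card_fin,
        mul_comm] at this
    · push Not at hb
      have h1 := sparse_of_girth hd hg F
        {v | ¬ A.BoundaryVertex v ∧ ∃ h, A.edge h ∈ F ∧ A.source h = v} (by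
          have : A.edge x₀.1.1.out ∈ F := ⟨x₀, hx₀, by simp⟩
          exact ⟨_, hb _ this, _, this, rfl⟩)
        fun h hh => ⟨hb h hh, h, hh, rfl⟩
      rw [hXc] at h1
      refine (hs.trans h1.le).trans ?_
      have hsub : (XU ×ˢ (Finset.univ : Finset (Fin d))).disjSum
          (∅ : Finset (Fin (p - d))) ⊆ s.biUnion t := by
        intro x hx
        rcases x with ⟨u, j⟩ | j
        · exact hin u (by simpa using hx) j
        · simp at hx
      have := Finset.card_le_card hsub
      rwa [Finset.card_disjSum, Finset.card_product, Finset.card_fin, Finset.card_empty, add_zero,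
        mul_comm] at this
  obtain ⟨f, hf, hft⟩ := (Finset.all_card_le_biUnion_card_iff_exists_injective t).1 hall
  -- Units and slots are equally many, so every slot is filled and each inner vertex receives
  -- exactly `d`.
  have hcard : Fintype.card (E' × Fin (d - 2)) = Fintype.card ((U × Fin d) ⊕ Fin (p - d)) := by
    have := A.card_inner_edges_mul (by omega) hdp hp
    simp only [Fintype.card_prod, Fintype.card_sum, Fintype.card_fin]
    have hE : Nat.card E' = {e | A.EdgeOnFace e A.boundary}ᶜ.ncard := Nat.card_coe_set_eq _
    have hU : Nat.card U = {v | A.BoundaryVertex v}ᶜ.ncard := Nat.card_coe_set_eq _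
    rwa [← hE, ← hU, Nat.card_eq_fintype_card, Nat.card_eq_fintype_card] at this
  have hbij : Function.Bijective f := (Fintype.bijective_iff_injective_and_card f).2 ⟨hf, hcard⟩
  have hex : ∀ x, ∃ h, A.edge h = x.1.1 ∧ good (f x) (A.source h) :=
    fun x => (Finset.mem_filter.1 (hft x)).2
  choose g hge hgg using hex
  refine ⟨fun h => (Finset.univ.filter fun x => g x = h).card, fun h hh => ?_, fun v hv => ?_⟩
  · rw [← Finset.card_union_of_disjoint (Finset.disjoint_filter.2
      fun x _ e1 e2 => A.opp_ne h (e2.symm.trans e1))]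
    have : (Finset.univ.filter fun x => g x = h) ∪ (Finset.univ.filter fun x => g x = A.opp h)
        = {(⟨A.edge h, hh⟩ : E')} ×ˢ Finset.univ := by
      ext x
      have := A.edge_eq_iff (h := h) (k := g x)
      rw [hge] at this
      simp only [Finset.mem_union, Finset.mem_filter, Finset.mem_univ, true_and, ← this,
        Finset.mem_product, Finset.mem_singleton, and_true, Subtype.ext_iff]
      exact eq_comm
    rw [this, Finset.card_product, Finset.card_singleton, Finset.card_fin, one_mul]
  · have h1 : ∑ h with A.source h = v, (Finset.univ.filter fun x => g x = h).card
        = (Finset.univ.filter fun x => A.source (g x) = v).card := by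
      rw [Finset.card_eq_sum_card_fiberwise (f := g)
        (t := Finset.univ.filter fun h => A.source h = v) (by intro x; simp)]
      refine Finset.sum_congr rfl fun h hh => ?_
      rw [Finset.filter_filter]
      congr 1
      ext x
      simp only [Finset.mem_filter, Finset.mem_univ, true_and, iff_and_self]
      rintro rfl
      exact (Finset.mem_filter.1 hh).2
    have h2 : (Finset.univ.filter fun x => A.source (g x) = v).card
        = (Finset.univ : Finset (Fin d)).card := by
      symm
      let ψ := (Equiv.ofBijective f hbij).symm
      have hψ : ∀ s, f (ψ s) = s := (Equiv.ofBijective f hbij).apply_symm_apply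
      refine Finset.card_bij (fun j _ => ψ (Sum.inl (⟨v, hv⟩, j))) ?_ ?_ ?_
      · intro j _
        have := hgg (ψ (Sum.inl (⟨v, hv⟩, j)))
        rw [hψ] at this
        exact Finset.mem_filter.2 ⟨Finset.mem_univ _, this.symm⟩
      · intro i _ j _ e
        simpa using ψ.injective e
      · intro x hx
        have hx := (Finset.mem_filter.1 hx).2
        have hgx := hgg x
        rw [hx] at hgx
        rcases hfx : f x with ⟨u, j⟩ | j
        · rw [hfx] at hgx
          refine ⟨j, Finset.mem_univ _, hf ?_⟩
          rw [hψ, hfx]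
          congr 2
          exact Subtype.ext (hgx : u.1 = v).symm
        · rw [hfx] at hgx
          exact absurd hgx hv
    convert h1.trans (h2.trans (Finset.card_fin d))

lemma exists_isPseudoOrientation (hd : 3 ≤ d) (hdp : d ≤ p)
    (hg : ∀ c : A.SimpleCycle, d ≤ c.len) : ∃ O : A.NBiorientation, A.IsPseudoOrientation O := by
  classical
  have hp : 3 ≤ p := by omega
  obtain ⟨w, hw, hv⟩ := A.exists_distribution hd hdp hg
  -- The weights of contour edges are forced; the condition `3 ≤ d` makes `d - 2` positive, hence
  -- the half-edge ingoing. Inner vertices meet no contour edge.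
  let w' : H → ℕ := fun h =>
    if A.rightFace h = A.boundary then 0 else if A.leftFace h = A.boundary then d - 2 else w h
  refine ⟨⟨{h | 0 < w' h}, w', fun h hh => hh, fun h hh => not_lt.1 hh⟩, ?_⟩
  rw [A.isPseudoOrientation_iff hp]
  refine ⟨fun h => ?_, fun v hbv => ?_, fun h hh => ?_⟩
  · change w' h + w' (A.opp h) = _
    by_cases hr : A.rightFace h = A.boundary
    · simp [w', hr, A.leftFace_ne_boundary hp hr]
    · by_cases hl : A.leftFace h = A.boundary
      · simp [w', hr, hl]
      · simp only [w', hr, hl, if_false, leftFace_opp, rightFace_opp]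
        exact hw h fun h1 => (A.edgeOnFace_boundary_iff h).1 h1 |>.elim hr hl
  · rw [NBiorientation.vertexWeight_eq]
    refine Eq.trans ?_ (hv v hbv)
    refine Finset.sum_congr rfl fun h hh => ?_
    have hs := (Finset.mem_filter.1 hh).2
    have hr : A.rightFace h ≠ A.boundary := fun hr => hbv ⟨h, hr, hs⟩
    have hl : A.leftFace h ≠ A.boundary := fun hl => hbv ⟨A.rot h, by simpa using hl, by simpa⟩
    simp [w', hr, hl]
  · simp only [Set.mem_ofPred_eq, w', hh, if_true, lt_irrefl, not_false_eq_true, true_and,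
      leftFace_opp, rightFace_opp, A.leftFace_ne_boundary hp hh, if_false]
    omega

end AnnularAngulation

/-! ### Existence and uniqueness of the minimal pseudo-orientation. -/

lemma PlanarMap.NBiorientation.ext_weight {H : Type*} [Fintype H] {M : PlanarMap H}
    {O O' : M.NBiorientation} (h : ∀ x, O.weight x = O'.weight x) : O = O' := by
  refine PlanarMap.NBiorientation.ext ?_ (funext h)
  ext x
  rw [O.mem_ingoing_iff, O'.mem_ingoing_iff, h]

namespace AnnularAngulation

open PlanarMap

variable {H : Type*} [Fintype H] {p d : ℕ} (A : AnnularAngulation H p d)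

variable {A} in
lemma IsPseudoOrientation.weight_of_rightFace {O : A.NBiorientation}
    (hO : A.IsPseudoOrientation O) (hp : 3 ≤ p) {h : H} (hh : A.rightFace h = A.boundary) :
    O.weight h = 0 ∧ O.weight (A.opp h) = d - 2 := by
  have h1 := ((A.isPseudoOrientation_iff hp O).1 hO).2.2 h hh
  have h2 := O.weight_nonpos h h1.1
  have h3 : O.weight h + O.weight (A.opp h) = d - 2 := hO.edge_weight h
  omega

variable {A} in
lemma IsPseudoOrientation.weight_of_leftFace {O : A.NBiorientation}
    (hO : A.IsPseudoOrientation O) (hp : 3 ≤ p) {h : H} (hh : A.leftFace h = A.boundary) :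
    O.weight h = d - 2 := by
  simpa using (hO.weight_of_rightFace hp (h := A.opp h) hh).2

/-- Increasing the weights on the left of a counterclockwise circuit. -/
lemma exists_push (hp : 3 ≤ p) {O : A.NBiorientation} (hO : A.IsPseudoOrientation O)
    (hmin : ¬ O.Minimal A.root) : ∃ O' : A.NBiorientation, A.IsPseudoOrientation O' ∧
      ∃ φ : A.Face → ℤ, (∀ f, 0 ≤ φ f) ∧ φ A.root = 0 ∧ (∃ f, f ≠ A.boundary ∧ 0 < φ f) ∧
        ∀ h, A.rightFace h ≠ A.boundary → A.leftFace h ≠ A.boundary →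
          (O'.weight h : ℤ) - O.weight h = φ (A.leftFace h) - φ (A.rightFace h) := by
  classical
  have hO' := (A.isPseudoOrientation_iff hp O).1 hO
  unfold NBiorientation.Minimal at hmin
  push Not at hmin
  obtain ⟨c, hc, hcc⟩ := hmin
  set T : Set A.Face := {f | Relation.ReflTransGen c.AdjOff A.root f} with hT
  have hsymm : Std.Symm c.AdjOff := by
    constructor
    rintro _ _ ⟨h, hh, rfl, rfl⟩
    exact ⟨A.opp h, by rwa [A.edge_opp], by simp, by simp⟩
  have hleft : ∀ i, A.leftFace (c.dart i) ∉ T := by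
    intro i hi
    exact hcc ⟨i, Std.Symm.symm _ _ hi⟩
  -- Only half-edges of this kind can lose weight. They are reverses of darts of the circuit, hence
  -- ingoing, so the truncated subtraction in `w` is exact.
  have hcross : ∀ h, A.leftFace h ∈ T → A.rightFace h ∉ T → 0 < O.weight h := by
    intro h hl hr
    have he : c.HasEdge (A.edge h) := by
      by_contra he
      exact hr (.tail hl ⟨A.opp h, by rwa [A.edge_opp], by simp, by simp⟩)
    obtain ⟨i, hi⟩ := he
    rcases A.edge_eq_iff.1 hi with rfl | rfl
    · exact absurd hl (hleft i)
    · exact O.weight_pos _ (hc i)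
  let φ : A.Face → ℤ := fun f => if f ∈ T then 0 else 1
  let w : H → ℕ := fun h => if A.rightFace h = A.boundary ∨ A.leftFace h = A.boundary
    then O.weight h
    else O.weight h + (if A.leftFace h ∈ T then 0 else 1) - (if A.rightFace h ∈ T then 0 else 1)
  have hw : ∀ h, A.rightFace h ≠ A.boundary → A.leftFace h ≠ A.boundary →
      (w h : ℤ) - O.weight h = φ (A.leftFace h) - φ (A.rightFace h) := by
    intro h hr hl
    have := hcross h
    by_cases h1 : A.leftFace h ∈ T <;> by_cases h2 : A.rightFace h ∈ T <;>
      simp [w, φ, hr, hl, h1, h2]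
    have := this h1 h2
    omega
  let O₂ : A.NBiorientation := ⟨{h | 0 < w h}, w, fun h hh => hh, fun h hh => not_lt.1 hh⟩
  refine ⟨O₂, ?_, φ, ?_, ?_, ?_, hw⟩
  · rw [A.isPseudoOrientation_iff hp]
    refine ⟨fun h => ?_, fun v hv => ?_, fun h hh => ?_⟩
    · rw [← hO.edge_weight h]
      change w h + w (A.opp h) = O.weight h + O.weight (A.opp h)
      by_cases hb : A.rightFace h = A.boundary ∨ A.leftFace h = A.boundary
      · simp [w, hb, hb.symm]
      · rw [not_or] at hb
        have h1 := hw h hb.1 hb.2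
        have h2 := hw (A.opp h) hb.2 (by simpa using hb.1)
        simp only [leftFace_opp, rightFace_opp] at h2
        omega
    · refine Eq.trans ?_ (hO.vertex_weight v hv)
      rw [NBiorientation.vertexWeight_eq, NBiorientation.vertexWeight_eq]
      zify
      rw [← sub_eq_zero, ← Finset.sum_sub_distrib, ← A.sum_curl_eq_zero φ v]
      refine Finset.sum_congr rfl fun h hh => ?_
      have hs := (Finset.mem_filter.1 hh).2
      exact hw h (fun hr => hv ⟨h, hr, hs⟩) (fun hl => hv ⟨A.rot h, by simpa using hl, by simpa⟩)
    · have h1 := hO'.2.2 h hh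
      rw [O.mem_ingoing_iff, O.mem_ingoing_iff] at h1
      change ¬ 0 < w h ∧ 0 < w (A.opp h)
      simpa [w, hh] using h1
  · intro f
    simp only [φ]
    split_ifs <;> simp
  · simp only [φ]
    rw [if_pos]
    exact .refl
  · refine ⟨A.leftFace (c.dart 0), fun hb => ?_, by simp [φ, hleft]⟩
    exact (hO'.2.2 (A.opp (c.dart 0)) hb).1 (hc 0)

/-- Pushes compose by adding potentials, and never return to the start: a potential without curl off
the contour equals its root value 0 on all non-boundary faces. On a finite set, some
pseudo-orientation thus admits no push. -/
lemma exists_minimal (hp : 3 ≤ p) {O₀ : A.NBiorientation} (hO₀ : A.IsPseudoOrientation O₀) :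
    ∃ O : A.NBiorientation, A.IsPseudoOrientation O ∧ O.Minimal A.root := by
  let P := {O : A.NBiorientation // A.IsPseudoOrientation O}
  have : Finite P := by
    refine Finite.of_injective (β := H → Fin (d - 2 + 1)) (fun O h => ⟨O.1.weight h, ?_⟩) ?_
    · have : O.1.weight h + O.1.weight (A.opp h) = d - 2 := O.2.edge_weight h
      omega
    · intro O O' h
      refine Subtype.ext (NBiorientation.ext_weight fun x => ?_)
      exact congrArg Fin.val (congr_fun h x)
  let R : P → P → Prop := fun O' O => ∃ φ : A.Face → ℤ, (∀ f, 0 ≤ φ f) ∧ φ A.root = 0 ∧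
    (∃ f, f ≠ A.boundary ∧ 0 < φ f) ∧
      ∀ h, A.rightFace h ≠ A.boundary → A.leftFace h ≠ A.boundary →
        (O'.1.weight h : ℤ) - O.1.weight h = φ (A.leftFace h) - φ (A.rightFace h)
  have : IsTrans P R := ⟨by
    rintro a b c ⟨φ, h1, h2, ⟨f, hf, h3⟩, h4⟩ ⟨ψ, g1, g2, -, g4⟩
    refine ⟨fun f => φ f + ψ f, fun f => add_nonneg (h1 f) (g1 f), by simp [h2, g2],
      ⟨f, hf, add_pos_of_pos_of_nonneg h3 (g1 f)⟩, fun h hr hl => ?_⟩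
    have := h4 h hr hl
    have := g4 h hr hl
    linarith⟩
  have : Std.Irrefl R := ⟨by
    rintro a ⟨φ, h1, h2, ⟨f, hf, h3⟩, h4⟩
    have := A.face_apply_eq_root hp φ (fun h hr hl => by
      have := h4 h hr hl
      linarith) f hf
    omega⟩
  obtain ⟨O, -, hO⟩ := (Finite.wellFounded_of_trans_of_irrefl R).has_min Set.univ ⟨⟨O₀, hO₀⟩, trivial⟩
  refine ⟨O.1, O.2, ?_⟩
  by_contra hmin
  obtain ⟨O', hO', h⟩ := A.exists_push hp O.2 hmin
  exact hO ⟨O', hO'⟩ trivial h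

/-- The difference of two pseudo-orientations derives from a potential on the non-boundary faces. -/
lemma exists_potential_sub {O O' : A.NBiorientation} (hO : A.IsPseudoOrientation O)
    (hO' : A.IsPseudoOrientation O') : ∃ q : A.Face → ℝ,
      ∀ h, A.rightFace h ≠ A.boundary → A.leftFace h ≠ A.boundary →
        q (A.leftFace h) - q (A.rightFace h) = (O'.weight h : ℝ) - O.weight h := by
  classical
  set z : H → ℝ := fun h => (O'.weight h : ℝ) - O.weight h with hzdef
  have hz : ∀ h, z (A.opp h) = - z h := by
    intro h
    have h1 : O.weight h + O.weight (A.opp h) = d - 2 := hO.edge_weight h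
    have h2 : O'.weight h + O'.weight (A.opp h) = d - 2 := hO'.edge_weight h
    have h3 : (O.weight h : ℝ) + O.weight (A.opp h) = O'.weight h + O'.weight (A.opp h) := by
      exact_mod_cast h1.trans h2.symm
    simp only [hzdef]
    linarith
  have hz0 : ∑ h, z h = 0 := by
    have := Equiv.sum_comp A.opp z
    simp only [hz, Finset.sum_neg_distrib] at this
    linarith
  -- Dropping the contour edges leaves only test functions constant along the contour. Conservation
  -- holds at the inner vertices, and the boundary vertices enter only through the total of `z`,
  -- which is zero by antisymmetry.
  obtain ⟨q, hq⟩ := A.exists_face_potential {e | ¬ A.EdgeOnFace e A.boundary} z hz (by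
    intro p hp
    have hb : ∀ v, A.BoundaryVertex v → p v = p (A.source A.boundary.out) := by
      rintro _ ⟨h, hh, rfl⟩
      refine (perm_induction (A.rightFace_eq_iff.1
        ((A.rightFace_out_eq A.boundary).trans hh.symm))
        (P := fun x => A.rightFace x = A.boundary ∧
          p (A.source x) = p (A.source A.boundary.out)) ⟨by simp, rfl⟩ ?_).2
      rintro x ⟨hx, e⟩
      simp only [Equiv.Perm.mul_apply, rightFace_rot_opp, hx, true_and, source_rot, source_opp]
      rw [← e]
      exact hp x fun hn => hn ((A.edgeOnFace_boundary_iff x).2 (Or.inl hx))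
    have h1 := A.sum_source_mul (fun v => p v - p (A.source A.boundary.out)) z (by
      intro v hv
      have hbv : ¬ A.BoundaryVertex v := fun hbv => hv (by simp [hb v hbv])
      have e1 := hO.vertex_weight v hbv
      have e2 := hO'.vertex_weight v hbv
      rw [NBiorientation.vertexWeight_eq] at e1 e2
      rw [Finset.sum_sub_distrib, sub_eq_zero]
      exact_mod_cast e2.trans e1.symm)
    simp only [sub_mul, Finset.sum_sub_distrib, ← Finset.mul_sum, hz0, mul_zero, sub_zero] at h1
    exact h1)
  exact ⟨q, fun h hr hl => hq h fun hn => ((A.edgeOnFace_boundary_iff h).1 hn).elim hr hl⟩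

/-- If the potential from `O` to `O'` exceeds its value at the root-face, then `O` has a
counterclockwise circuit. -/
lemma not_minimal_of_potential (hp : 3 ≤ p) {O O' : A.NBiorientation}
    (hO : A.IsPseudoOrientation O) (hO' : A.IsPseudoOrientation O') (q : A.Face → ℝ)
    (hq : ∀ h, A.rightFace h ≠ A.boundary → A.leftFace h ≠ A.boundary →
      q (A.leftFace h) - q (A.rightFace h) = (O'.weight h : ℝ) - O.weight h)
    (hf : ∃ f, f ≠ A.boundary ∧ q A.root < q f) : ¬ O.Minimal A.root := by
  obtain ⟨f₀, hf₀, hqf₀⟩ := hf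
  obtain ⟨f, hfb, hmax⟩ := Set.exists_max_image {f | f ≠ A.boundary} q (Set.toFinite _) ⟨f₀, hf₀⟩
  have hroot : q A.root < q f := hqf₀.trans_le (hmax f₀ hf₀)
  set S : Set A.Face := {g | g ≠ A.boundary ∧ q g = q f} with hS
  -- Paths of faces avoiding the top level `S`; they may pass through the boundary face. The cut
  -- around the part `T` reached from the root-face then has faces of `S` on its far side.
  let R : A.Face → A.Face → Prop :=
    fun f g => f ∉ S ∧ g ∉ S ∧ ∃ h, A.rightFace h = f ∧ A.leftFace h = g
  have hrS : A.root ∉ S := fun h => hroot.ne h.2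
  set T : Set A.Face := {g | Relation.ReflTransGen R A.root g} with hT
  have hTS : ∀ g ∈ T, g ∉ S := by
    intro g hg
    rcases Relation.ReflTransGen.cases_tail hg with rfl | ⟨_, _, h⟩
    · exact hrS
    · exact h.2.1
  have hfT : f ∈ Tᶜ := fun h => hTS f h ⟨hfb, rfl⟩
  obtain ⟨c, hc⟩ := exists_simpleCycle_of_faces (M := A.toPlanarMap) (S := Tᶜ) (g := A.root) hfT
    (fun h => h .refl)
  have hcr : ∀ i, A.rightFace (c.dart i) ∈ T := fun i => not_not.1 (hc i).2
  have hcl : ∀ i, A.leftFace (c.dart i) ∈ S := by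
    intro i
    by_contra hn
    exact (hc i).1 (.tail (hcr i) ⟨hTS _ (hcr i), hn, _, rfl, rfl⟩)
  have hcirc : O.IsCircuit c := by
    intro i
    change A.opp (c.dart i) ∈ O.ingoing
    by_cases hb : A.rightFace (c.dart i) = A.boundary
    · exact (((A.isPseudoOrientation_iff hp O).1 hO).2.2 _ hb).2
    -- From right to left `q` strictly rises, so `O'` gives this half more weight than `O`, and `O`
    -- must give positive weight to the other half.
    · have h1 := hq _ hb (hcl i).1
      have h2 : q (A.rightFace (c.dart i)) < q f :=
        lt_of_le_of_ne (hmax _ hb) fun e => hTS _ (hcr i) ⟨hb, e⟩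
      rw [(hcl i).2] at h1
      have h3 : (O.weight (c.dart i) : ℝ) < O'.weight (c.dart i) := by linarith
      have h4 : O.weight (c.dart i) < O'.weight (c.dart i) := by exact_mod_cast h3
      have h5 : O.weight (c.dart i) + O.weight (A.opp (c.dart i)) = d - 2 := hO.edge_weight _
      have h6 : O'.weight (c.dart i) + O'.weight (A.opp (c.dart i)) = d - 2 := hO'.edge_weight _
      rw [O.mem_ingoing_iff]
      omega
  intro hmin
  refine hmin c hcirc ?_
  rintro ⟨i, hi⟩
  -- This potential is constant on `T` and on the faces left of `c`, with a jump of 1 between, so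
  -- the root-face is not on the left.
  obtain ⟨ψ, h1, h2⟩ := c.exists_separating_potential
  have hψT : ∀ g ∈ T, ψ g = ψ A.root := by
    intro g hg
    induction (hg : Relation.ReflTransGen R A.root g) with
    | refl => rfl
    | tail _ hbc ih =>
      obtain ⟨hb, hc', h, rfl, rfl⟩ := hbc
      rw [h2 h, ih]
      rintro ⟨j, hj⟩
      rcases A.edge_eq_iff.1 hj with rfl | rfl
      · exact hc' (hcl j)
      · exact hb (hcl j)
  have hψ : ∀ g, Relation.ReflTransGen c.AdjOff (A.leftFace (c.dart i)) g →
      ψ g = ψ (A.leftFace (c.dart i)) := by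
    intro g hg
    induction hg with
    | refl => rfl
    | tail _ h ih =>
      obtain ⟨h, hh, rfl, rfl⟩ := h
      rw [h2 h hh, ih]
  have e1 := hψ _ hi
  have e2 := h1 i
  rw [hψT _ (hcr i)] at e2
  linarith

/-- Minimality of `O` keeps the potential from exceeding its root value, and minimality of `O'`,
with the opposite potential, from falling below it. So the weights agree off the contour, and on the
contour they are forced. -/
lemma eq_of_minimal (hp : 3 ≤ p) {O O' : A.NBiorientation}
    (hO : A.IsPseudoOrientation O) (hO' : A.IsPseudoOrientation O') (hm : O.Minimal A.root)
    (hm' : O'.Minimal A.root) : O = O' := by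
  obtain ⟨q, hq⟩ := A.exists_potential_sub hO hO'
  have hconst : ∀ f, f ≠ A.boundary → q f = q A.root := by
    intro f hf
    rcases lt_trichotomy (q A.root) (q f) with h | h | h
    · exact absurd hm (A.not_minimal_of_potential hp hO hO' q hq ⟨f, hf, h⟩)
    · exact h.symm
    · refine absurd hm' (A.not_minimal_of_potential hp hO' hO (fun f => - q f) (fun h hr hl => ?_)
        ⟨f, hf, neg_lt_neg h⟩)
      have := hq h hr hl
      linarith
  refine NBiorientation.ext_weight fun h => ?_
  by_cases hr : A.rightFace h = A.boundary
  · rw [(hO.weight_of_rightFace hp hr).1, (hO'.weight_of_rightFace hp hr).1]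
  · by_cases hl : A.leftFace h = A.boundary
    · rw [hO.weight_of_leftFace hp hl, hO'.weight_of_leftFace hp hl]
    · have := hq h hr hl
      rw [hconst _ hr, hconst _ hl, sub_self] at this
      exact_mod_cast (sub_eq_zero.1 this.symm).symm

lemma le_girth_iff {H : Type*} [Fintype H] (M : PlanarMap H) (d : ℕ) :
    (d : ℕ∞) ≤ M.girth ↔ ∀ c : M.SimpleCycle, d ≤ c.len := by
  simp [PlanarMap.girth]

end AnnularAngulation

theorem proposition5p2 {H : Type*} [Fintype H] (p d : ℕ) (hd : 3 ≤ d) (hdp : d ≤ p)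
    (A : AnnularAngulation H p d) :
    ((∃ O : A.NBiorientation, A.IsPseudoOrientation O) ↔ A.girth = (d : ℕ∞)) ∧
    (A.girth = (d : ℕ∞) →
      ∃ O : A.NBiorientation,
        (A.IsPseudoOrientation O ∧ O.Minimal A.root) ∧
        (∀ O' : A.NBiorientation,
          A.IsPseudoOrientation O' ∧ O'.Minimal A.root → O' = O) ∧
        ∀ v, A.BoundaryVertex v → O.AccessibleFrom v) := by
  have hp : 3 ≤ p := hd.trans hdp
  have hlen : A.girth = (d : ℕ∞) → ∀ c : A.SimpleCycle, d ≤ c.len := fun hg =>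
    (AnnularAngulation.le_girth_iff _ d).1 hg.ge
  refine ⟨⟨?_, fun hg => A.exists_isPseudoOrientation hd hdp (hlen hg)⟩, fun hg => ?_⟩
  · rintro ⟨O, hO⟩
    refine le_antisymm ?_ ((AnnularAngulation.le_girth_iff _ d).2
      (A.le_len_of_isPseudoOrientation (by omega) O hO))
    obtain ⟨c, hc⟩ := A.exists_simpleCycle_len_le
    exact (iInf_le _ c).trans (by exact_mod_cast hc)
  · obtain ⟨O₀, hO₀⟩ := A.exists_isPseudoOrientation hd hdp (hlen hg)
    obtain ⟨O, hO, hm⟩ := A.exists_minimal hp hO₀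
    exact ⟨O, ⟨hO, hm⟩, fun O' hO' => A.eq_of_minimal hp hO'.1 hO hO'.2 hm,
      A.accessibleFrom_of_boundaryVertex hd hdp (hlen hg) O hO⟩
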